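/- For a set $A$ of nonnegative integers and integers $d\ge 1$, $n\ge 0$, let $r_d(n;A)$ be the number of ordered $d$-tuples $(k_1,\dots,k_d)\in A^d$ with $k_1+\cdots+k_d=n$. Call $B$ an asymptotic $h$-basis if every sufficiently large integer is a sum of $h$ (not necessarily distinct) elements of $B$. For a real function $f$ that is defined and differentiable on some half-line $[\alpha,+\infty)$, call an asymptotic $h$-basis $B$ *$\Theta(f)$-regular* if for every integer $d\ge h$ $$r_d(n;B)\asymp f'(n)\,f(n)^{d-1}\qquad(n\to+\infty),$$ that is, there are constants $c_1,c_2>0$ (which may depend on $d$) with $c_1\,|f'(n)f(n)^{d-1}|\le r_d(n;B)\le c_2\,|f'(n)f(n)^{d-1}|$ for all sufficiently large integers $n$. **Theorem.** For every integer $h\ge 2$ there exists an infinite set $B$ of nonnegative integers that is a $\Theta\big(x^{1/h}\log(x)^{1/h}\big)$-regular asymptotic $h$-basis. -/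

import Mathlib

open Filter Asymptotics

/-- The representation function `r_d(n; A)`: the sum of `r(k₁; A) ⋯ r(k_d; A)` over all ordered
`d`-tuples of nonnegative integers with `k₁ + ⋯ + k_d = n`, where `r(·; A)` is the characteristic
function of `A`. -/
noncomputable def repFun (d : ℕ) (A : Set ℕ) (n : ℕ) : ℕ :=
  ∑ k ∈ Finset.Nat.antidiagonalTuple d n, ∏ i, A.indicator (fun _ => 1) (k i)

/-- `B` is an asymptotic `h`-basis: every sufficiently large integer is a sum of `h` (not
necessarily distinct) elements of `B`. -/
def IsAsymptoticBasis (h : ℕ) (B : Set ℕ) : Prop :=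
  ∀ᶠ n : ℕ in atTop, ∃ k : Fin h → ℕ, (∀ i, k i ∈ B) ∧ ∑ i, k i = n

/-- `B` is a `Θ(f)`-regular asymptotic `h`-basis (`h ≥ 1`), for a real function `f` which is
differentiable on some half-line: `r_d(n; B) ≍ f'(n) f(n)^(d-1)` for every `d ≥ h`. -/
structure IsThetaRegularBasis (f : ℝ → ℝ) (h : ℕ) (B : Set ℕ) : Prop where
  differentiable : ∀ᶠ x : ℝ in atTop, DifferentiableAt ℝ f x
  isAsymptoticBasis : IsAsymptoticBasis h B
  isTheta : ∀ d : ℕ, h ≤ d →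
    (fun n : ℕ => (repFun d B n : ℝ)) =Θ[atTop] fun n : ℕ => deriv f n * f n ^ (d - 1)

/-! Write f for `growth h`. Since f^h = x log x and f' ≍ f/x, the target f' f^(h+j-1) is of order
log x · f^j. The case j = 0 is the Erdős–Tetali theorem `exists_repFun_bounds`; the other cases
follow from it deterministically. Comparing sums of r_h with h-th powers of the counting function
shows that B has ≍ f(n) elements up to n, and each further summand multiplies the representation
count by this order (`exists_eventually_repFun_le`, `exists_eventually_le_repFun`).

For j = 0, take B = S ∪ T inside a finite window, with S and T independent random sets containing x
with probability C f(x)/x. The upper bound rests on disjoint representations: k disjoint supports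
occur with probability at most z^(-k) exp(zμ), where μ bounds the expected number of representations
(`pairProb_disjoint_family_le`). For l < h summands μ is a negative power of n, so k = O(1)
suffices; for l = h, μ = O(log n) and k = O(log n) suffices. A maximal disjoint family meets every
representation, so bounds on such families become bounds on r_l by induction on l
(`repFun_succ_le_of_disjoint`).

The lower bound counts representations with one summand in T and h-1 in S. Once S is fixed, with
r_(h-1) ≤ K and enough elements, this count is a sum of independent variables in [0, K] with mean a
large multiple of log n, and an elementary exponential moment bound applies
(`pairProb_sum_repFun_le`). Two independent sets are used to get this independence. The constant K
does not depend on C, so C can be chosen after K.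

All failure probabilities are O(n^(-2)), so their sum over a window starting far enough out is below
1. The resulting sets, one for each window, are merged into one by an ultrafilter limit. -/

/-! ### Representation functions, counting functions and disjoint representations -/

/-- The ordered `d`-tuples of elements of `A` with sum `n`. -/
noncomputable def repTuples (d : ℕ) (A : Set ℕ) (n : ℕ) : Finset (Fin d → ℕ) := by
  classical exact (Finset.Nat.antidiagonalTuple d n).filter fun k => ∀ i, k i ∈ A

theorem mem_repTuples {d : ℕ} {A : Set ℕ} {n : ℕ} {k : Fin d → ℕ} :
    k ∈ repTuples d A n ↔ ∑ i, k i = n ∧ ∀ i, k i ∈ A := by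
  classical
  simp [repTuples, Finset.Nat.mem_antidiagonalTuple]

theorem repFun_eq_card (d : ℕ) (A : Set ℕ) (n : ℕ) : repFun d A n = (repTuples d A n).card := by
  classical
  unfold repFun repTuples
  rw [Finset.card_filter]
  refine Finset.sum_congr rfl fun k _ => ?_
  simp only [Set.indicator_apply, Finset.prod_boole, Finset.mem_univ, true_imp_iff]

theorem repFun_mono (d : ℕ) {A A' : Set ℕ} (h : A ⊆ A') (n : ℕ) :
    repFun d A n ≤ repFun d A' n := by
  rw [repFun_eq_card, repFun_eq_card]
  refine Finset.card_le_card fun k hk => ?_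
  rw [mem_repTuples] at hk ⊢
  exact ⟨hk.1, fun i => h (hk.2 i)⟩

theorem repFun_congr (d : ℕ) {A A' : Set ℕ} (n : ℕ) (h : ∀ x ≤ n, (x ∈ A ↔ x ∈ A')) :
    repFun d A n = repFun d A' n := by
  rw [repFun_eq_card, repFun_eq_card]
  congr 1
  ext k
  rw [mem_repTuples, mem_repTuples]
  refine and_congr_right fun hk => forall_congr' fun i => h _ ?_
  rw [← hk]
  exact Finset.single_le_sum (f := k) (fun _ _ => Nat.zero_le _) (Finset.mem_univ i)

theorem repFun_zero_le (A : Set ℕ) (n : ℕ) : repFun 0 A n ≤ 1 := by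
  rw [repFun_eq_card]
  refine Finset.card_le_one.2 fun a _ b _ => Subsingleton.elim a b

open Classical in
theorem repFun_succ (d : ℕ) (A : Set ℕ) (n : ℕ) :
    repFun (d + 1) A n = ∑ a ∈ Finset.range (n + 1), if a ∈ A then repFun d A (n - a) else 0 := by
  rw [← Finset.Nat.sum_antidiagonal_eq_sum_range_succ (fun a b => if a ∈ A then repFun d A b else 0)]
  simp only [repFun_eq_card]
  rw [← Finset.sum_filter, ← Finset.card_sigma]
  refine Finset.card_bij' (fun k _ => ⟨(k 0, ∑ i, Fin.tail k i), Fin.tail k⟩)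
    (fun x _ => Fin.cons x.1.1 x.2) ?_ ?_ ?_ ?_
  · intro k hk
    rw [mem_repTuples, Fin.sum_univ_succ] at hk
    simp only [Finset.mem_sigma, Finset.mem_filter, Finset.HasAntidiagonal.mem_antidiagonal, mem_repTuples]
    exact ⟨⟨hk.1, hk.2 0⟩, trivial, fun i => hk.2 _⟩
  · rintro ⟨⟨a, b⟩, k⟩ hk
    simp only [Finset.mem_sigma, Finset.mem_filter, Finset.HasAntidiagonal.mem_antidiagonal, mem_repTuples] at hk
    rw [mem_repTuples, Fin.sum_univ_succ]
    simp only [Fin.cons_zero, Fin.cons_succ]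
    refine ⟨by rw [hk.2.1]; exact hk.1.1, fun i => ?_⟩
    refine Fin.cases ?_ (fun j => ?_) i
    · exact hk.1.2
    · exact hk.2.2 j
  · intro k hk
    simp
  · rintro ⟨⟨a, b⟩, k⟩ hk
    simp only [Finset.mem_sigma, Finset.mem_filter, Finset.HasAntidiagonal.mem_antidiagonal, mem_repTuples] at hk
    obtain ⟨_, rfl, _⟩ := hk
    simp

theorem repFun_le_pow (d : ℕ) (A : Set ℕ) (n : ℕ) : repFun d A n ≤ (n + 1) ^ d := by
  classical
  induction d generalizing n with
  | zero => simpa using repFun_zero_le A n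
  | succ d ih =>
    rw [repFun_succ]
    calc _ ≤ ∑ a ∈ Finset.range (n + 1), (n + 1) ^ d := by
          refine Finset.sum_le_sum fun a _ => ?_
          split_ifs
          · exact (ih _).trans (Nat.pow_le_pow_left (by omega) _)
          · exact Nat.zero_le _
      _ = (n + 1) ^ (d + 1) := by simp [pow_succ, mul_comm]

/-- The number of elements of `A` which are at most `n`. -/
noncomputable def countUpTo (A : Set ℕ) (n : ℕ) : ℕ := by
  classical exact ((Finset.range (n + 1)).filter (· ∈ A)).card

/-- A tuple of sum at most `M` has all coordinates at most `M`. Together with `pow_le_sum_repFun`,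
this links averages of the representation function to the counting function. -/
theorem sum_repFun_le_pow (d : ℕ) (A : Set ℕ) (M : ℕ) :
    ∑ m ∈ Finset.range (M + 1), repFun d A m ≤ countUpTo A M ^ d := by
  classical
  simp only [repFun_eq_card]
  rw [← Finset.card_sigma]
  have : countUpTo A M ^ d =
      (Fintype.piFinset fun _ : Fin d => (Finset.range (M + 1)).filter (· ∈ A)).card := by
    rw [Fintype.card_piFinset]; simp [countUpTo]
  rw [this]
  refine Finset.card_le_card_of_injOn (fun x => x.2) ?_ ?_
  · rintro ⟨m, k⟩ hk
    simp only [Finset.coe_sigma, Set.mem_sigma_iff, Finset.mem_coe, mem_repTuples,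
      Finset.mem_range, Fintype.mem_piFinset, Finset.mem_filter] at hk ⊢
    refine fun i => ⟨?_, hk.2.2 i⟩
    have := Finset.single_le_sum (f := k) (fun _ _ => Nat.zero_le _) (Finset.mem_univ i)
    omega
  · rintro ⟨m, k⟩ hk ⟨m', k'⟩ hk' (rfl : k = k')
    simp only [Finset.coe_sigma, Set.mem_sigma_iff, Finset.mem_coe, mem_repTuples] at hk hk'
    obtain rfl : m = m' := hk.2.1.symm.trans hk'.2.1
    rfl

theorem pow_le_sum_repFun (d : ℕ) (A : Set ℕ) (M : ℕ) :
    countUpTo A M ^ d ≤ ∑ m ∈ Finset.range (d * M + 1), repFun d A m := by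
  classical
  simp only [repFun_eq_card]
  rw [← Finset.card_sigma]
  have : countUpTo A M ^ d =
      (Fintype.piFinset fun _ : Fin d => (Finset.range (M + 1)).filter (· ∈ A)).card := by
    rw [Fintype.card_piFinset]; simp [countUpTo]
  rw [this]
  refine Finset.card_le_card_of_injOn (fun k => ⟨∑ i, k i, k⟩) ?_ ?_
  · intro k hk
    simp only [Finset.coe_sigma, Set.mem_sigma_iff, Finset.mem_coe, mem_repTuples,
      Finset.mem_range, Fintype.mem_piFinset, Finset.mem_filter] at hk ⊢
    refine ⟨?_, trivial, fun i => (hk i).2⟩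
    have := Finset.sum_le_card_nsmul Finset.univ k M (fun i _ => by have := (hk i).1; omega)
    simp only [Finset.card_univ, Fintype.card_fin, smul_eq_mul] at this
    exact Nat.lt_succ_of_le this
  · intro k _ k' _ h
    simpa using (Sigma.mk.inj_iff.1 h).2

/-- If `n` has at most `k` representations with pairwise disjoint supports, then it has few
representations. -/
theorem repFun_succ_le_of_disjoint (l : ℕ) (A : Set ℕ) (n K k : ℕ)
    (hK : ∀ m ≤ n, repFun l A m ≤ K)
    (hk : ∀ F ⊆ repTuples (l + 1) A n,
      (F : Set (Fin (l + 1) → ℕ)).PairwiseDisjoint (fun t => Finset.univ.image t) → F.card ≤ k) :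
    repFun (l + 1) A n ≤ (l + 1) * ((l + 1) * k) * K := by
  classical
  let P : Finset (Finset (Fin (l + 1) → ℕ)) := (repTuples (l + 1) A n).powerset.filter fun F =>
    (F : Set (Fin (l + 1) → ℕ)).PairwiseDisjoint (fun t => Finset.univ.image t)
  -- By maximality of `F`, the union `U` of its supports meets every representation; otherwise a
  -- further disjoint one could be added.
  obtain ⟨F, hF, hmax⟩ := Finset.exists_max_image P Finset.card ⟨∅, by simp [P]⟩
  simp only [P, Finset.mem_filter, Finset.mem_powerset] at hF hmax
  set U := F.biUnion fun t => Finset.univ.image t with hU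
  have hUcard : U.card ≤ (l + 1) * k := by
    calc U.card ≤ F.card * (l + 1) := Finset.card_biUnion_le_card_mul _ _ _ fun t _ =>
          Finset.card_image_le.trans (by simp)
      _ ≤ k * (l + 1) := Nat.mul_le_mul_right _ (hk F hF.1 hF.2)
      _ = _ := mul_comm _ _
  have hhit : ∀ t ∈ repTuples (l + 1) A n, ∃ i, t i ∈ U := by
    intro t ht
    by_contra hcon
    push Not at hcon
    have htF : t ∉ F := fun h =>
      hcon 0 (Finset.mem_biUnion.2 ⟨t, h, Finset.mem_image_of_mem _ (Finset.mem_univ _)⟩)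
    have := hmax (insert t F) ⟨Finset.insert_subset ht hF.1, by
      rw [Finset.coe_insert]
      refine hF.2.insert fun s hs _ => ?_
      rw [Finset.disjoint_left]
      intro x hx hx'
      obtain ⟨i, _, rfl⟩ := Finset.mem_image.1 hx
      exact hcon i (Finset.mem_biUnion.2 ⟨s, hs, hx'⟩)⟩
    rw [Finset.card_insert_of_notMem htF] at this
    omega
  have hsub : repTuples (l + 1) A n ⊆ ((Finset.univ : Finset (Fin (l + 1))) ×ˢ U).biUnion
      fun x => (repTuples (l + 1) A n).filter fun t => t x.1 = x.2 := by
    intro t ht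
    obtain ⟨i, hi⟩ := hhit t ht
    exact Finset.mem_biUnion.2 ⟨(i, t i), by simp [hi], by simp [ht]⟩
  rw [repFun_eq_card]
  calc (repTuples (l + 1) A n).card
      ≤ ((Finset.univ : Finset (Fin (l + 1))) ×ˢ U).card * K := by
        refine (Finset.card_le_card hsub).trans (Finset.card_biUnion_le_card_mul _ _ _ ?_)
        rintro ⟨i, x⟩ _
        refine le_trans ?_ (hK (n - x) (Nat.sub_le _ _))
        rw [repFun_eq_card]
        -- With the value `x` at coordinate `i` fixed, deleting that coordinate leaves a
        -- representation of `n - x` by `l` elements.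
        refine Finset.card_le_card_of_injOn (fun t => i.removeNth t) ?_ ?_
        · intro t ht
          simp only [Finset.coe_filter, mem_repTuples, Set.mem_ofPred_eq, Finset.mem_coe] at ht ⊢
          obtain ⟨⟨hs, hA⟩, hx⟩ := ht
          rw [Fin.sum_univ_succAbove _ i] at hs
          refine ⟨?_, fun j => hA _⟩
          simp only [Fin.removeNth]
          omega
        · intro t ht t' ht' heq
          simp only [Finset.coe_filter, mem_repTuples, Set.mem_ofPred_eq] at ht ht'
          rw [← Fin.insertNth_self_removeNth i t, ← Fin.insertNth_self_removeNth i t', ht.2, ht'.2]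
          simp only at heq
          rw [heq]
    _ ≤ (l + 1) * ((l + 1) * k) * K := by
        rw [Finset.card_product, Finset.card_univ, Fintype.card_fin]
        gcongr

/-! ### Independent random subsets of a finite set -/

/-- The probability that the random subset of `V`, which contains each `x` independently with
probability `p x`, equals `S`. -/
noncomputable def bernoulliWeight (V : Finset ℕ) (p : ℕ → ℝ) (S : Finset ℕ) : ℝ :=
  (∏ x ∈ S, p x) * ∏ x ∈ V \ S, (1 - p x)

/-- The mean of `F` over the random subset of `V`. -/
noncomputable def bernoulliMean (V : Finset ℕ) (p : ℕ → ℝ) (F : Finset ℕ → ℝ) : ℝ :=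
  ∑ S ∈ V.powerset, bernoulliWeight V p S * F S

section Bernoulli

variable {V : Finset ℕ} {p : ℕ → ℝ}

theorem bernoulliWeight_nonneg (hp : ∀ x ∈ V, 0 ≤ p x ∧ p x ≤ 1) {S : Finset ℕ} (hS : S ⊆ V) :
    0 ≤ bernoulliWeight V p S :=
  mul_nonneg (Finset.prod_nonneg fun x hx => (hp x (hS hx)).1)
    (Finset.prod_nonneg fun x hx => sub_nonneg.2 (hp x (Finset.mem_sdiff.1 hx).1).2)

theorem bernoulliMean_mono (hp : ∀ x ∈ V, 0 ≤ p x ∧ p x ≤ 1) {F F' : Finset ℕ → ℝ}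
    (h : ∀ S ⊆ V, F S ≤ F' S) : bernoulliMean V p F ≤ bernoulliMean V p F' :=
  Finset.sum_le_sum fun S hS => mul_le_mul_of_nonneg_left (h S (Finset.mem_powerset.1 hS))
    (bernoulliWeight_nonneg hp (Finset.mem_powerset.1 hS))

theorem bernoulliMean_add (F F' : Finset ℕ → ℝ) :
    bernoulliMean V p (fun S => F S + F' S) = bernoulliMean V p F + bernoulliMean V p F' := by
  simp only [bernoulliMean, mul_add, Finset.sum_add_distrib]

theorem bernoulliMean_sum {ι : Type*} (I : Finset ι) (F : ι → Finset ℕ → ℝ) :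
    bernoulliMean V p (fun S => ∑ i ∈ I, F i S) = ∑ i ∈ I, bernoulliMean V p (F i) := by
  simp only [bernoulliMean, Finset.mul_sum]
  exact Finset.sum_comm

theorem bernoulliMean_const_mul (c : ℝ) (F : Finset ℕ → ℝ) :
    bernoulliMean V p (fun S => c * F S) = c * bernoulliMean V p F := by
  simp only [bernoulliMean, Finset.mul_sum]
  exact Finset.sum_congr rfl fun S _ => by ring

theorem bernoulliMean_mul_const (c : ℝ) (F : Finset ℕ → ℝ) :
    bernoulliMean V p (fun S => F S * c) = bernoulliMean V p F * c := by
  simp only [mul_comm _ c, bernoulliMean_const_mul]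

theorem bernoulliMean_prod (a : ℕ → ℝ) :
    bernoulliMean V p (fun S => ∏ x ∈ S, a x) = ∏ x ∈ V, (p x * a x + (1 - p x)) := by
  rw [Finset.prod_add]
  refine Finset.sum_congr rfl fun S _ => ?_
  rw [bernoulliWeight, Finset.prod_mul_distrib]
  ring

theorem bernoulliMean_const (c : ℝ) : bernoulliMean V p (fun _ => c) = c := by
  have := bernoulliMean_prod (V := V) (p := p) fun _ => 1
  simp only [Finset.prod_const_one, mul_one, add_sub_cancel] at this
  rw [show (fun _ : Finset ℕ => c) = fun _ => c * 1 by simp, bernoulliMean_const_mul, this, mul_one]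

/-- Independence gives equality when `T ⊆ V`; otherwise the event is impossible. The inequality form
makes a hypothesis `T ⊆ V` unnecessary. -/
theorem bernoulliMean_subset_le (hp : ∀ x, 0 ≤ p x) (T : Finset ℕ) :
    bernoulliMean V p (fun S => if T ⊆ S then 1 else 0) ≤ ∏ x ∈ T, p x := by
  by_cases hT : T ⊆ V
  · refine le_of_eq ?_
    have key : ∏ x ∈ V, (p x + if x ∈ T then 0 else 1 - p x) = ∏ x ∈ T, p x := by
      rw [← Finset.prod_sdiff hT, Finset.prod_eq_one, one_mul]
      · exact Finset.prod_congr rfl fun x hx => by simp [hx]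
      · intro x hx
        simp [(Finset.mem_sdiff.1 hx).2]
    rw [← key, Finset.prod_add]
    refine Finset.sum_congr rfl fun S hS => ?_
    rw [bernoulliWeight, mul_assoc]
    congr 1
    beta_reduce
    split_ifs with hTS
    · rw [mul_one]
      refine Finset.prod_congr rfl fun x hx => ?_
      rw [if_neg fun h => (Finset.mem_sdiff.1 hx).2 (hTS h)]
    · rw [mul_zero]
      obtain ⟨x, hxT, hxS⟩ := Finset.not_subset.1 hTS
      exact (Finset.prod_eq_zero (Finset.mem_sdiff.2 ⟨hT hxT, hxS⟩) (by simp [hxT])).symm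
  · refine le_trans (le_of_eq ?_) (Finset.prod_nonneg fun x _ => hp x)
    refine Finset.sum_eq_zero fun S hS => ?_
    beta_reduce
    rw [if_neg fun h => hT (h.trans (Finset.mem_powerset.1 hS)), mul_zero]

/-- Lower tail of a sum of independent random variables `w a` on `a ∈ S`. -/
theorem bernoulliMean_lower_tail (hp : ∀ x ∈ V, 0 ≤ p x ∧ p x ≤ 1) (w : ℕ → ℕ) (K L Λ : ℝ)
    (hK : 1 ≤ K) (hw : ∀ a ∈ V, (w a : ℝ) ≤ K) (hΛ : Λ ≤ ∑ a ∈ V, p a * w a) :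
    bernoulliMean V p (fun S => if ((∑ a ∈ S, w a : ℕ) : ℝ) ≤ L then 1 else 0)
      ≤ Real.exp (L - Λ / (2 * K)) := by
  have h1 : bernoulliMean V p (fun S => if ((∑ a ∈ S, w a : ℕ) : ℝ) ≤ L then 1 else 0)
      ≤ bernoulliMean V p (fun S => Real.exp L * ∏ a ∈ S, Real.exp (-(w a : ℝ))) := by
    refine bernoulliMean_mono hp fun S _ => ?_
    rw [← Real.exp_sum, ← Real.exp_add]
    split_ifs with h
    · rw [Finset.sum_neg_distrib]
      push_cast at h
      exact Real.one_le_exp (by linarith)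
    · exact (Real.exp_pos _).le
  refine h1.trans ?_
  rw [bernoulliMean_const_mul, bernoulliMean_prod, sub_eq_add_neg, Real.exp_add]
  refine mul_le_mul_of_nonneg_left ?_ (Real.exp_pos _).le
  have h2 : ∀ a ∈ V, p a * Real.exp (-(w a : ℝ)) + (1 - p a)
      ≤ Real.exp (-(p a * w a) / (2 * K)) := by
    intro a ha
    -- Here it matters that `w a` is an integer: it is 0, or at least 1, and then the left side is
    -- below 1/2 while the right side is at least 1/2.
    have hexp : Real.exp (-(w a : ℝ)) ≤ 1 - w a / (2 * K) := by
      rcases Nat.eq_zero_or_pos (w a) with h0 | h0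
      · simp [h0]
      · have h3 : Real.exp (-(w a : ℝ)) ≤ 1 / 2 := by
          have : Real.exp (-(w a : ℝ)) ≤ Real.exp (-1) := by
            apply Real.exp_le_exp.2
            have : (1 : ℝ) ≤ w a := by exact_mod_cast h0
            linarith
          have h4 := Real.exp_neg_one_lt_half
          linarith
        have h5 : (w a : ℝ) / (2 * K) ≤ 1 / 2 := by
          rw [div_le_div_iff₀ (by linarith) (by norm_num)]
          linarith [hw a ha]
        linarith
    have h6 := Real.add_one_le_exp (-(p a * w a) / (2 * K))
    have h7 := mul_le_mul_of_nonneg_left hexp (hp a ha).1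
    have h8 : p a * (1 - w a / (2 * K)) = p a + -(p a * w a) / (2 * K) := by ring
    linarith
  calc _ ≤ ∏ a ∈ V, Real.exp (-(p a * w a) / (2 * K)) := by
        refine Finset.prod_le_prod (fun a ha => ?_) h2
        have := hp a ha
        have := mul_nonneg this.1 (Real.exp_pos (-(w a : ℝ))).le
        linarith
    _ = Real.exp (-(∑ a ∈ V, p a * w a) / (2 * K)) := by
        rw [← Real.exp_sum, ← Finset.sum_div, Finset.sum_neg_distrib]
    _ ≤ _ := by
        apply Real.exp_le_exp.2
        rw [neg_div, neg_le_neg_iff]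
        gcongr

open Classical in
/-- The probability of an event that depends on two independent random subsets of `V`. -/
noncomputable def pairProb (V : Finset ℕ) (p : ℕ → ℝ) (Φ : Finset ℕ → Finset ℕ → Prop) : ℝ :=
  bernoulliMean V p fun S => bernoulliMean V p fun T => if Φ S T then 1 else 0

theorem pairProb_or_le (hp : ∀ x ∈ V, 0 ≤ p x ∧ p x ≤ 1) (Φ Ψ : Finset ℕ → Finset ℕ → Prop) :
    pairProb V p (fun S T => Φ S T ∨ Ψ S T) ≤ pairProb V p Φ + pairProb V p Ψ := by
  classical
  simp only [pairProb]
  rw [← bernoulliMean_add]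
  refine bernoulliMean_mono hp fun S _ => ?_
  rw [← bernoulliMean_add]
  refine bernoulliMean_mono hp fun T _ => ?_
  by_cases h1 : Φ S T <;> by_cases h2 : Ψ S T <;> simp [h1, h2]

theorem pairProb_exists_le (hp : ∀ x ∈ V, 0 ≤ p x ∧ p x ≤ 1) {ι : Type*} (I : Finset ι)
    (Φ : ι → Finset ℕ → Finset ℕ → Prop) :
    pairProb V p (fun S T => ∃ i ∈ I, Φ i S T) ≤ ∑ i ∈ I, pairProb V p (Φ i) := by
  classical
  simp only [pairProb]
  rw [← bernoulliMean_sum]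
  refine bernoulliMean_mono hp fun S _ => ?_
  rw [← bernoulliMean_sum]
  refine bernoulliMean_mono hp fun T _ => ?_
  split_ifs with h
  · obtain ⟨i, hi, hΦ⟩ := h
    calc (1 : ℝ) = if Φ i S T then 1 else 0 := by simp [hΦ]
      _ ≤ _ := Finset.single_le_sum (f := fun i => if Φ i S T then (1 : ℝ) else 0)
        (fun j _ => by split_ifs <;> norm_num) hi
  · exact Finset.sum_nonneg fun j _ => by split_ifs <;> norm_num

theorem exists_not_of_pairProb_lt_one (hp : ∀ x ∈ V, 0 ≤ p x ∧ p x ≤ 1)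
    {Φ : Finset ℕ → Finset ℕ → Prop} (h : pairProb V p Φ < 1) :
    ∃ S T, S ⊆ V ∧ T ⊆ V ∧ ¬ Φ S T := by
  classical
  by_contra hcon
  push Not at hcon
  refine absurd h (not_lt.2 ?_)
  calc (1 : ℝ) = bernoulliMean V p fun _ => bernoulliMean V p fun _ => 1 := by
        simp only [bernoulliMean_const]
    _ ≤ _ := bernoulliMean_mono hp fun S hS => bernoulliMean_mono hp fun T hT => by
        rw [if_pos (hcon S T hS hT)]

/-- Conditioning on the first random set. -/
theorem pairProb_le_of_forall (hp : ∀ x ∈ V, 0 ≤ p x ∧ p x ≤ 1) {c : ℝ}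
    {Φ : Finset ℕ → Finset ℕ → Prop}
    (h : ∀ S ⊆ V, (open Classical in bernoulliMean V p fun T => if Φ S T then 1 else 0) ≤ c) :
    pairProb V p Φ ≤ c :=
  (bernoulliMean_mono hp h).trans_eq (bernoulliMean_const c)

/-- Union bound over the part `R` of `U` that lies in `S`, the rest being in `T`. For upper bounds,
the union thus behaves like one random set of density `2 * p`. -/
theorem pairProb_subset_union_le (hp : ∀ x ∈ V, 0 ≤ p x ∧ p x ≤ 1) (hp0 : ∀ x, 0 ≤ p x)
    (U : Finset ℕ) :
    pairProb V p (fun S T => U ⊆ S ∪ T) ≤ ∏ x ∈ U, (2 * p x) := by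
  classical
  have h1 : pairProb V p (fun S T => U ⊆ S ∪ T) ≤ bernoulliMean V p fun S =>
      bernoulliMean V p fun T => ∑ R ∈ U.powerset,
        (if R ⊆ S then (1 : ℝ) else 0) * (if U \ R ⊆ T then 1 else 0) := by
    refine bernoulliMean_mono hp fun S _ => bernoulliMean_mono hp fun T _ => ?_
    split_ifs with h
    · calc (1 : ℝ) = (if U ∩ S ⊆ S then (1 : ℝ) else 0) * (if U \ (U ∩ S) ⊆ T then 1 else 0) := by
            rw [if_pos Finset.inter_subset_right, if_pos, mul_one]
            intro x hx
            simp only [Finset.mem_sdiff, Finset.mem_inter, not_and] at hx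
            exact (Finset.mem_union.1 (h hx.1)).resolve_left (hx.2 hx.1)
        _ ≤ _ := Finset.single_le_sum
            (f := fun R => (if R ⊆ S then (1 : ℝ) else 0) * (if U \ R ⊆ T then 1 else 0))
            (fun R _ => by split_ifs <;> norm_num)
            (Finset.mem_powerset.2 Finset.inter_subset_left)
    · exact Finset.sum_nonneg fun R _ => by split_ifs <;> norm_num
  refine h1.trans ?_
  simp only [bernoulliMean_sum, bernoulliMean_const_mul, bernoulliMean_mul_const]
  calc _ ≤ ∑ R ∈ U.powerset, (∏ x ∈ R, p x) * ∏ x ∈ U \ R, p x := by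
        refine Finset.sum_le_sum fun R _ => ?_
        refine mul_le_mul (bernoulliMean_subset_le hp0 _) (bernoulliMean_subset_le hp0 _) ?_
          (Finset.prod_nonneg fun x _ => hp0 x)
        calc (0 : ℝ) = bernoulliMean V p fun _ => 0 := by rw [bernoulliMean_const]
          _ ≤ _ := bernoulliMean_mono hp fun T _ => by split_ifs <;> norm_num
    _ = ∏ x ∈ U, (2 * p x) := by
        rw [← Finset.prod_add]
        exact Finset.prod_congr rfl fun x _ => by ring

/-- It is unlikely that the random set contains many pairwise disjoint members of a family of
sets with small total weight. -/
theorem pairProb_disjoint_family_le (hp : ∀ x ∈ V, 0 ≤ p x ∧ p x ≤ 1) (hp0 : ∀ x, 0 ≤ p x)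
    {ι : Type*} (I : Finset ι) (f : ι → Finset ℕ) (k : ℕ) (z μ : ℝ) (hz : 1 ≤ z)
    (hμ : ∑ i ∈ I, ∏ x ∈ f i, (2 * p x) ≤ μ) :
    pairProb V p (fun S T => ∃ F ⊆ I, (F : Set ι).PairwiseDisjoint f ∧ k ≤ F.card ∧
      ∀ i ∈ F, f i ⊆ S ∪ T) ≤ (z ^ k)⁻¹ * Real.exp (z * μ) := by
  classical
  have hz0 : 0 < z := by linarith
  have hw : ∀ i, 0 ≤ ∏ x ∈ f i, (2 * p x) := fun i =>
    Finset.prod_nonneg fun x _ => mul_nonneg (by norm_num) (hp0 x)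
  -- Markov-type bound: the indicator is at most the sum of z^(|F| - k) over all disjoint families
  -- `F` whose members occur, as a witness contributes at least 1.
  have h1 : pairProb V p (fun S T => ∃ F ⊆ I, (F : Set ι).PairwiseDisjoint f ∧ k ≤ F.card ∧
      ∀ i ∈ F, f i ⊆ S ∪ T) ≤ bernoulliMean V p fun S => bernoulliMean V p fun T =>
      ∑ F ∈ I.powerset.filter (fun F : Finset ι => (F : Set ι).PairwiseDisjoint f),
        ((z ^ k)⁻¹ * z ^ F.card) * (if F.biUnion f ⊆ S ∪ T then 1 else 0) := by
    refine bernoulliMean_mono hp fun S _ => bernoulliMean_mono hp fun T _ => ?_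
    have hnn : ∀ F : Finset ι, 0 ≤ ((z ^ k)⁻¹ * z ^ F.card) *
        (if F.biUnion f ⊆ S ∪ T then (1 : ℝ) else 0) := fun F => by
      split_ifs <;> positivity
    split_ifs with h
    · obtain ⟨F, hFI, hd, hc, hs⟩ := h
      calc (1 : ℝ) ≤ ((z ^ k)⁻¹ * z ^ F.card) * (if F.biUnion f ⊆ S ∪ T then 1 else 0) := by
            rw [if_pos (Finset.biUnion_subset.2 hs), mul_one, inv_mul_eq_div,
              one_le_div (by positivity)]
            exact pow_le_pow_right₀ hz hc
        _ ≤ _ := Finset.single_le_sum (f := fun F : Finset ι => ((z ^ k)⁻¹ * z ^ F.card) *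
            (if F.biUnion f ⊆ S ∪ T then (1 : ℝ) else 0)) (fun F _ => hnn F)
            (Finset.mem_filter.2 ⟨Finset.mem_powerset.2 hFI, hd⟩)
    · exact Finset.sum_nonneg fun F _ => hnn F
  refine h1.trans ?_
  simp only [bernoulliMean_sum, bernoulliMean_const_mul]
  calc _ ≤ ∑ F ∈ I.powerset.filter (fun F : Finset ι => (F : Set ι).PairwiseDisjoint f),
        (z ^ k)⁻¹ * ∏ i ∈ F, (z * ∏ x ∈ f i, (2 * p x)) := by
        refine Finset.sum_le_sum fun F hF => ?_
        rw [mul_assoc]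
        refine mul_le_mul_of_nonneg_left ?_ (by positivity)
        rw [Finset.prod_mul_distrib, Finset.prod_const,
          ← Finset.prod_biUnion (Finset.mem_filter.1 hF).2]
        refine mul_le_mul_of_nonneg_left ?_ (by positivity)
        refine le_trans (le_of_eq ?_) (pairProb_subset_union_le hp hp0 (F.biUnion f))
        rw [pairProb]
        refine congrArg _ (funext fun S => congrArg _ (funext fun T => ?_))
        by_cases h : F.biUnion f ⊆ S ∪ T
        · rw [if_pos h, if_pos h]
        · rw [if_neg h, if_neg h]
    -- Disjointness has done its work in factoring the probabilities. Dropping it makes the sum over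
    -- `F` a product over `I`.
    _ ≤ ∑ F ∈ I.powerset, (z ^ k)⁻¹ * ∏ i ∈ F, (z * ∏ x ∈ f i, (2 * p x)) := by
        refine Finset.sum_le_sum_of_subset_of_nonneg (Finset.filter_subset _ _) fun F _ _ => ?_
        exact mul_nonneg (by positivity)
          (Finset.prod_nonneg fun i _ => mul_nonneg hz0.le (hw i))
    _ = (z ^ k)⁻¹ * ∏ i ∈ I, (1 + z * ∏ x ∈ f i, (2 * p x)) := by
        rw [← Finset.mul_sum, Finset.prod_one_add]
    _ ≤ (z ^ k)⁻¹ * ∏ i ∈ I, Real.exp (z * ∏ x ∈ f i, (2 * p x)) := by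
        refine mul_le_mul_of_nonneg_left ?_ (by positivity)
        refine Finset.prod_le_prod
          (fun i _ => add_nonneg zero_le_one (mul_nonneg hz0.le (hw i))) fun i _ => ?_
        linarith [Real.add_one_le_exp (z * ∏ x ∈ f i, (2 * p x))]
    _ ≤ _ := by
        rw [← Real.exp_sum, ← Finset.mul_sum]
        gcongr

end Bernoulli

/-! ### Expected number of representations, allowing repeated summands -/

open Classical in
/-- Tuples with a prescribed pattern `π` of coinciding coordinates, weighted over all classes
but that of `i₀`. -/
theorem sum_pattern_le {l : ℕ} (n : ℕ) (q : ℕ → ℝ) (hq : ∀ x, 0 ≤ q x) (Q : ℝ) (hQ1 : 1 ≤ Q)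
    (hQ : ∑ x ∈ Finset.range (n + 1), q x ≤ Q) (π : Fin l → Fin l) (i₀ : Fin l) (hi₀ : π i₀ = i₀) :
    ∑ t ∈ (Finset.Nat.antidiagonalTuple l n).filter (fun t => ∀ i, t (π i) = t i),
      ∏ j ∈ (Finset.univ.image π).erase i₀, q (t j) ≤ Q ^ (l - 1) := by
  set J := (Finset.univ.image π).erase i₀ with hJ
  have hJcard : J.card ≤ l - 1 := by
    have h1 : i₀ ∈ Finset.univ.image π := Finset.mem_image.2 ⟨i₀, Finset.mem_univ _, hi₀⟩
    rw [hJ, Finset.card_erase_of_mem h1]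
    exact Nat.sub_le_sub_right (Finset.card_image_le.trans (by simp)) 1
  -- Forget all coordinates outside `J`. Nothing is lost on tuples of pattern `π`: the other
  -- coordinates are copies of those in `J` or of `t i₀`, and the fixed sum `n` determines `t i₀`.
  let v : (Fin l → ℕ) → Fin l → ℕ := fun t j => if j ∈ J then t j else 0
  let s : Fin l → Finset ℕ := fun j => if j ∈ J then Finset.range (n + 1) else {0}
  let g : Fin l → ℕ → ℝ := fun j x => if j ∈ J then q x else 1
  have hg : ∀ j x, 0 ≤ g j x := fun j x => by
    simp only [g]; split_ifs
    · exact hq x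
    · exact zero_le_one
  have hv : ∀ t, ∏ j ∈ J, q (t j) = ∏ j, g j (v t j) := by
    intro t
    simp only [g, v]
    rw [Finset.prod_ite_mem, Finset.univ_inter]
    exact Finset.prod_congr rfl fun j hj => by rw [if_pos hj]
  have hinj : Set.InjOn v ((Finset.Nat.antidiagonalTuple l n).filter
      (fun t => ∀ i, t (π i) = t i) : Finset (Fin l → ℕ)) := by
    intro t ht t' ht' heq
    simp only [Finset.coe_filter, Finset.Nat.mem_antidiagonalTuple, Set.mem_ofPred_eq] at ht ht'
    have hJeq : ∀ j ∈ J, t j = t' j := fun j hj => by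
      have := congrFun heq j
      simpa only [v, if_pos hj] using this
    have hle : ∀ t t' : Fin l → ℕ, (∀ i, t (π i) = t i) → (∀ i, t' (π i) = t' i) →
        (∀ j ∈ J, t j = t' j) → t i₀ ≤ t' i₀ → ∀ i, t i ≤ t' i := by
      intro t t' h h' hj hlt i
      rw [← h, ← h']
      by_cases hi : π i = i₀
      · rw [hi]; exact hlt
      · exact (hj _ (Finset.mem_erase.2
          ⟨hi, Finset.mem_image_of_mem _ (Finset.mem_univ _)⟩)).le
    have heq_of : ∀ t t' : Fin l → ℕ, (∀ i, t i ≤ t' i) → ∑ i, t i = ∑ i, t' i → t = t' := by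
      intro t t' h hs
      funext i
      exact (Finset.sum_eq_sum_iff_of_le fun i _ => h i).1 hs i (Finset.mem_univ i)
    rcases le_total (t i₀) (t' i₀) with h | h
    · exact heq_of t t' (hle t t' ht.2 ht'.2 hJeq h) (ht.1.trans ht'.1.symm)
    · exact (heq_of t' t (hle t' t ht'.2 ht.2 (fun j hj => (hJeq j hj).symm) h)
        (ht'.1.trans ht.1.symm)).symm
  simp only [hv]
  rw [← Finset.sum_image (f := fun u : Fin l → ℕ => ∏ j, g j (u j)) hinj]
  calc _ ≤ ∑ u ∈ Fintype.piFinset s, ∏ j, g j (u j) := by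
        refine Finset.sum_le_sum_of_subset_of_nonneg ?_ fun u _ _ =>
          Finset.prod_nonneg fun j _ => hg j _
        intro u hu
        obtain ⟨t, ht, rfl⟩ := Finset.mem_image.1 hu
        rw [Finset.mem_filter, Finset.Nat.mem_antidiagonalTuple] at ht
        refine Fintype.mem_piFinset.2 fun j => ?_
        simp only [s, v]
        split_ifs
        · rw [Finset.mem_range, Nat.lt_succ_iff, ← ht.1]
          exact Finset.single_le_sum (f := t) (fun _ _ => Nat.zero_le _) (Finset.mem_univ j)
        · exact Finset.mem_singleton_self _
    _ = ∏ j, ∑ x ∈ s j, g j x := (Finset.prod_univ_sum s g).symm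
    _ ≤ ∏ j, if j ∈ J then Q else 1 := by
        refine Finset.prod_le_prod (fun j _ => Finset.sum_nonneg fun x _ => hg j x) fun j _ => ?_
        by_cases hj : j ∈ J
        · simpa [s, g, hj] using hQ
        · simp [s, g, hj]
    _ = Q ^ J.card := by rw [Finset.prod_ite_mem, Finset.univ_inter, Finset.prod_const]
    _ ≤ Q ^ (l - 1) := pow_le_pow_right₀ hQ1 hJcard

/-- The expected number of representations of `n` as a sum of `l` elements of a random set. -/
theorem sum_antidiagonalTuple_prod_image_le {l : ℕ} (hl : 1 ≤ l) (n : ℕ) (q : ℕ → ℝ)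
    (hq : ∀ x, 0 ≤ q x) (M Q : ℝ) (hM : ∀ x, n ≤ l * x → x ≤ n → q x ≤ M) (hM0 : 0 ≤ M)
    (hQ1 : 1 ≤ Q) (hQ : ∑ x ∈ Finset.range (n + 1), q x ≤ Q) :
    ∑ t ∈ Finset.Nat.antidiagonalTuple l n, ∏ x ∈ Finset.univ.image t, q x
      ≤ (l : ℝ) ^ l * l * (M * Q ^ (l - 1)) := by
  classical
  have : NeZero l := ⟨by omega⟩
  -- The weight charges each distinct value once, so one representative index is picked for each
  -- value. The index `i₀` of a largest coordinate, which is at least `n / l`, represents its own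
  -- value and contributes the factor `M`.
  have hpat : ∀ t ∈ Finset.Nat.antidiagonalTuple l n, ∃ (π : Fin l → Fin l) (i₀ : Fin l),
      π i₀ = i₀ ∧ (∀ i, t (π i) = t i) ∧
      ∏ x ∈ Finset.univ.image t, q x ≤ M * ∏ j ∈ (Finset.univ.image π).erase i₀, q (t j) := by
    intro t ht
    rw [Finset.Nat.mem_antidiagonalTuple] at ht
    obtain ⟨i₀, -, hmax⟩ := Finset.exists_max_image (Finset.univ : Finset (Fin l)) t
      ⟨0, Finset.mem_univ _⟩
    have hbig : n ≤ l * t i₀ := by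
      have := Finset.sum_le_card_nsmul Finset.univ t (t i₀) hmax
      rw [ht] at this
      simpa using this
    have hsmall : t i₀ ≤ n := by
      rw [← ht]
      exact Finset.single_le_sum (f := t) (fun _ _ => Nat.zero_le _) (Finset.mem_univ i₀)
    have hex : ∀ i, ∃ j, t j = t i := fun i => ⟨i, rfl⟩
    let ρ : ℕ → Fin l := fun x => if x = t i₀ then i₀ else
      if h : ∃ j, t j = x then h.choose else i₀
    have hρ : ∀ i, t (ρ (t i)) = t i := by
      intro i
      simp only [ρ]
      split_ifs with h h'
      · exact h.symm
      · exact h'.choose_spec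
      · exact absurd ⟨i, rfl⟩ h'
    have hρ₀ : ρ (t i₀) = i₀ := by simp [ρ]
    refine ⟨fun i => ρ (t i), i₀, hρ₀, hρ, ?_⟩
    have himg : Finset.univ.image t = (Finset.univ.image fun i => ρ (t i)).image t := by
      rw [Finset.image_image]
      exact Finset.image_congr fun i _ => (hρ i).symm
    rw [himg, Finset.prod_image]
    · rw [← Finset.mul_prod_erase _ _ (Finset.mem_image.2 ⟨i₀, Finset.mem_univ _, hρ₀⟩)]
      exact mul_le_mul_of_nonneg_right (hM _ hbig hsmall) (Finset.prod_nonneg fun j _ => hq _)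
    · intro a ha b hb hab
      simp only [Finset.coe_image, Finset.coe_univ, Set.image_univ, Set.mem_range] at ha hb
      obtain ⟨i, rfl⟩ := ha
      obtain ⟨j, rfl⟩ := hb
      rw [hρ, hρ] at hab
      rw [hab]
  let I : Finset ((Fin l → Fin l) × Fin l) := Finset.univ.filter fun x => x.1 x.2 = x.2
  have hnn : ∀ (x : (Fin l → Fin l) × Fin l) (t : Fin l → ℕ),
      0 ≤ M * ∏ j ∈ (Finset.univ.image x.1).erase x.2, q (t j) := fun x t =>
    mul_nonneg hM0 (Finset.prod_nonneg fun j _ => hq _)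
  calc ∑ t ∈ Finset.Nat.antidiagonalTuple l n, ∏ x ∈ Finset.univ.image t, q x
      ≤ ∑ t ∈ Finset.Nat.antidiagonalTuple l n, ∑ x ∈ I, if ∀ i, t (x.1 i) = t i then
          M * ∏ j ∈ (Finset.univ.image x.1).erase x.2, q (t j) else 0 := by
        refine Finset.sum_le_sum fun t ht => ?_
        obtain ⟨π, i₀, h1, h2, h3⟩ := hpat t ht
        refine h3.trans ?_
        refine le_trans (le_of_eq ?_) (Finset.single_le_sum
          (f := fun x : (Fin l → Fin l) × Fin l => if ∀ i, t (x.1 i) = t i then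
            M * ∏ j ∈ (Finset.univ.image x.1).erase x.2, q (t j) else 0) (fun x _ => ?_)
          (show (π, i₀) ∈ I by simp [I, h1]))
        · simp only [if_pos h2]
        · split_ifs
          · exact hnn x t
          · exact le_rfl
    _ = ∑ x ∈ I, M * ∑ t ∈ (Finset.Nat.antidiagonalTuple l n).filter
          (fun t => ∀ i, t (x.1 i) = t i),
          ∏ j ∈ (Finset.univ.image x.1).erase x.2, q (t j) := by
        rw [Finset.sum_comm]
        refine Finset.sum_congr rfl fun x _ => ?_
        rw [← Finset.sum_filter, Finset.mul_sum]
    _ ≤ ∑ x ∈ I, M * Q ^ (l - 1) := by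
        refine Finset.sum_le_sum fun x hx => mul_le_mul_of_nonneg_left ?_ hM0
        exact sum_pattern_le n q hq Q hQ1 hQ x.1 x.2 (Finset.mem_filter.1 hx).2
    _ ≤ _ := by
        rw [Finset.sum_const, nsmul_eq_mul]
        refine mul_le_mul_of_nonneg_right ?_ (by positivity)
        have : I.card ≤ l ^ l * l := (Finset.card_filter_le _ _).trans (by simp)
        exact_mod_cast this

/-! ### Estimates for the growth function -/

/-- The function `x ^ (1 / h) * log x ^ (1 / h)`. -/
noncomputable def growth (h : ℕ) (x : ℝ) : ℝ := x ^ (1 / (h : ℝ)) * Real.log x ^ (1 / (h : ℝ))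

section Growth

variable {h : ℕ}

theorem growth_nonneg {x : ℝ} (hx : 1 ≤ x) : 0 ≤ growth h x := by
  have := Real.log_nonneg hx
  unfold growth
  positivity

theorem growth_natCast_nonneg (hh : 1 ≤ h) (n : ℕ) : 0 ≤ growth h n := by
  rcases Nat.eq_zero_or_pos n with rfl | hn
  · have : (h : ℝ) ≠ 0 := by positivity
    simp [growth, this]
  · exact growth_nonneg (by exact_mod_cast hn)

theorem growth_pow (hh : 1 ≤ h) {x : ℝ} (hx : 1 ≤ x) : growth h x ^ h = x * Real.log x := by
  have hh0 : h ≠ 0 := by omega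
  rw [growth, mul_pow, one_div, Real.rpow_inv_natCast_pow (by linarith) hh0,
    Real.rpow_inv_natCast_pow (Real.log_nonneg hx) hh0]

theorem growth_mono {x y : ℝ} (hx : 1 ≤ x) (hxy : x ≤ y) : growth h x ≤ growth h y := by
  have := Real.log_nonneg hx
  have := Real.log_le_log (by linarith) hxy
  have hy : 0 ≤ y := by linarith
  unfold growth
  gcongr

theorem one_le_log_of_three_le {x : ℝ} (hx : 3 ≤ x) : 1 ≤ Real.log x := by
  rw [Real.le_log_iff_exp_le (by linarith)]
  exact Real.exp_one_lt_three.le.trans hx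

theorem rpow_le_growth {x : ℝ} (hx : 3 ≤ x) : x ^ (1 / (h : ℝ)) ≤ growth h x := by
  have h1 : 1 ≤ Real.log x ^ (1 / (h : ℝ)) :=
    Real.one_le_rpow (one_le_log_of_three_le hx) (by positivity)
  have h2 : 0 ≤ x ^ (1 / (h : ℝ)) := Real.rpow_nonneg (by linarith) _
  unfold growth
  nlinarith

theorem one_le_growth {x : ℝ} (hx : 3 ≤ x) : 1 ≤ growth h x :=
  (Real.one_le_rpow (by linarith) (by positivity)).trans (rpow_le_growth hx)

/-- From `D ^ 2 ≤ n` it follows that n ≤ x², so the logarithm loses only a factor 2; then compare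
h-th powers. -/
theorem growth_le_of_div_le (hh : 1 ≤ h) {D n x : ℝ} (hD : 1 ≤ D) (hn : D ^ 2 ≤ n)
    (hx : n / D ≤ x) : growth h n ≤ 2 * D * growth h x := by
  have hn1 : 1 ≤ n := le_trans (one_le_pow₀ hD) hn
  have hDn : D ≤ n / D := by rw [le_div_iff₀ (by linarith)]; nlinarith
  have hx1 : 1 ≤ x := hD.trans (hDn.trans hx)
  have hnx : n ≤ x ^ 2 := by
    have h1 : n ≤ x * D := (div_le_iff₀ (by linarith)).1 hx
    have h2 : D ≤ x := hDn.trans hx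
    nlinarith
  have hlog : Real.log n ≤ 2 * Real.log x := by
    have := Real.log_le_log (by linarith) hnx
    rwa [Real.log_pow] at this
  have hlogn := Real.log_nonneg hn1
  have hlogx := Real.log_nonneg hx1
  refine le_of_pow_le_pow_left₀ (n := h) (by omega)
    (mul_nonneg (by linarith) (growth_nonneg hx1)) ?_
  rw [mul_pow, growth_pow hh hn1, growth_pow hh hx1]
  have h1 : n ≤ x * D := (div_le_iff₀ (by linarith)).1 hx
  calc n * Real.log n ≤ (x * D) * (2 * Real.log x) := by gcongr
    _ = (2 * D) ^ 1 * (x * Real.log x) := by ring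
    _ ≤ (2 * D) ^ h * (x * Real.log x) := by
        gcongr
        · linarith

/-- A discrete form of the integral of x^(α-1); Bernoulli's inequality for exponents at most 1
bounds each increment of the right side from below. -/
theorem sum_rpow_sub_one_le {α : ℝ} (hα : 0 < α) (hα1 : α ≤ 1) (n : ℕ) :
    ∑ x ∈ Finset.range n, ((x + 1 : ℕ) : ℝ) ^ (α - 1) ≤ (n : ℝ) ^ α / α := by
  induction n with
  | zero => simp [Real.zero_rpow hα.ne']
  | succ n ih =>
    rw [Finset.sum_range_succ]
    have hpos : (0 : ℝ) < ((n + 1 : ℕ) : ℝ) := by positivity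
    set y : ℝ := ((n + 1 : ℕ) : ℝ) with hy
    have hyn : (n : ℝ) = y * (1 + -(1 / y)) := by
      rw [mul_add, mul_neg, mul_one_div_cancel hpos.ne', hy]; push_cast; ring
    have hy1 : 1 / y ≤ 1 := by
      rw [div_le_one hpos, hy]; push_cast; linarith [Nat.cast_nonneg (α := ℝ) n]
    have key : (n : ℝ) ^ α ≤ y ^ α - α * y ^ (α - 1) := by
      rw [hyn, Real.mul_rpow hpos.le (by linarith)]
      have h1 := rpow_one_add_le_one_add_mul_self (s := -(1 / y)) (by linarith) hα.le hα1
      have h2 : y ^ α * (1 + α * -(1 / y)) = y ^ α - α * y ^ (α - 1) := by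
        rw [Real.rpow_sub_one hpos.ne']; ring
      rw [← h2]
      gcongr
    have : (n : ℝ) ^ α / α ≤ y ^ α / α - y ^ (α - 1) := by
      rw [div_le_iff₀ hα, sub_mul, div_mul_cancel₀ _ hα.ne']
      linarith
    linarith

theorem sum_growth_div_le (hh : 1 ≤ h) (n : ℕ) (hn : 1 ≤ n) :
    ∑ x ∈ Finset.range (n + 1), growth h x / x ≤ h * growth h n := by
  have hh0 : (0 : ℝ) < h := by exact_mod_cast hh
  have hn1 : (1 : ℝ) ≤ n := by exact_mod_cast hn
  rw [Finset.sum_range_succ']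
  simp only [Nat.cast_zero, div_zero, add_zero]
  have hα1 : 1 / (h : ℝ) ≤ 1 := by rw [div_le_one hh0]; exact_mod_cast hh
  calc ∑ x ∈ Finset.range n, growth h ((x + 1 : ℕ) : ℝ) / ((x + 1 : ℕ) : ℝ)
      ≤ ∑ x ∈ Finset.range n, ((x + 1 : ℕ) : ℝ) ^ (1 / (h : ℝ) - 1) *
          Real.log n ^ (1 / (h : ℝ)) := by
        refine Finset.sum_le_sum fun x hx => ?_
        have hx0 : (0 : ℝ) < ((x + 1 : ℕ) : ℝ) := by positivity
        have hxn : ((x + 1 : ℕ) : ℝ) ≤ n := by exact_mod_cast Finset.mem_range.1 hx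
        have hx1 : (1 : ℝ) ≤ ((x + 1 : ℕ) : ℝ) := by push_cast; linarith [Nat.cast_nonneg (α := ℝ) x]
        rw [growth, mul_div_right_comm, ← Real.rpow_sub_one hx0.ne']
        have h0 := Real.log_nonneg hx1
        have h1 := Real.log_le_log hx0 hxn
        gcongr
    _ ≤ (n : ℝ) ^ (1 / (h : ℝ)) / (1 / (h : ℝ)) * Real.log n ^ (1 / (h : ℝ)) := by
        rw [← Finset.sum_mul]
        have h0 := Real.log_nonneg hn1
        have := sum_rpow_sub_one_le (α := 1 / (h : ℝ)) (by positivity) hα1 n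
        gcongr
    _ = h * growth h n := by rw [growth]; field_simp

theorem eventually_mul_log_le_rpow (c : ℝ) {s : ℝ} (hs : 0 < s) :
    ∀ᶠ n : ℕ in atTop, c * Real.log n ≤ (n : ℝ) ^ s := by
  have h1 : ∀ᶠ x : ℝ in atTop, c * Real.log x ≤ x ^ s := by
    have h2 := (isLittleO_log_rpow_atTop hs).bound (c := (|c| + 1)⁻¹) (by positivity)
    filter_upwards [h2, eventually_ge_atTop 1] with x hx hx1
    rw [Real.norm_of_nonneg (Real.log_nonneg hx1),
      Real.norm_of_nonneg (Real.rpow_nonneg (by linarith) _), inv_mul_eq_div,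
      le_div_iff₀ (by positivity)] at hx
    have := Real.log_nonneg hx1
    nlinarith [le_abs_self c]
  exact tendsto_natCast_atTop_atTop.eventually h1

theorem eventually_mul_log_le_growth (hh : 1 ≤ h) (c : ℝ) :
    ∀ᶠ n : ℕ in atTop, c * Real.log n ≤ growth h n := by
  have hh0 : (0 : ℝ) < h := by exact_mod_cast hh
  filter_upwards [eventually_mul_log_le_rpow c (s := 1 / (h : ℝ)) (by positivity),
    eventually_ge_atTop 3] with n hn h3
  exact hn.trans (rpow_le_growth (by exact_mod_cast h3))

/-- The quotient equals log n / f(n), and f(n) ≥ n^(1/h) is at least the square of n^(1/(2h)): one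
factor absorbs `c` log n, the other remains. -/
theorem eventually_growth_pow_pred_div_le (hh : 1 ≤ h) {c : ℝ} (_hc : 0 ≤ c) :
    ∀ᶠ n : ℕ in atTop, c * (growth h n ^ (h - 1) / n) ≤ ((n : ℝ) ^ (1 / (2 * h : ℝ)))⁻¹ := by
  have hh0 : (0 : ℝ) < h := by exact_mod_cast hh
  filter_upwards [eventually_mul_log_le_rpow c (s := 1 / (2 * h : ℝ)) (by positivity),
    eventually_ge_atTop 3] with n hn h3
  have h3' : (3 : ℝ) ≤ n := by exact_mod_cast h3
  have hn0 : (0 : ℝ) < n := by linarith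
  have hG := one_le_growth (h := h) h3'
  have hpow := growth_pow hh (x := n) (by linarith)
  obtain ⟨k, rfl⟩ : ∃ k, h = k + 1 := ⟨h - 1, by omega⟩
  rw [pow_succ] at hpow
  have h1 : growth (k + 1) n ^ (k + 1 - 1) / n = Real.log n / growth (k + 1) n := by
    rw [Nat.add_sub_cancel, div_eq_div_iff hn0.ne' (by linarith), hpow]; ring
  have hsq : (n : ℝ) ^ (1 / ((k + 1 : ℕ) : ℝ)) =
      (n : ℝ) ^ (1 / (2 * (k + 1 : ℕ) : ℝ)) * (n : ℝ) ^ (1 / (2 * (k + 1 : ℕ) : ℝ)) := by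
    rw [← Real.rpow_add hn0]; congr 1; field_simp; norm_num
  have hr := rpow_le_growth (h := k + 1) h3'
  rw [hsq] at hr
  set z := (n : ℝ) ^ (1 / (2 * (k + 1 : ℕ) : ℝ)) with hz
  have hz0 : 0 < z := Real.rpow_pos_of_pos hn0 _
  rw [h1, ← mul_div_assoc, inv_eq_one_div, div_le_div_iff₀ (by linarith) hz0]
  nlinarith

/-- Supplies the union bound over all `n`, uniformly in the length `N` of the window. -/
theorem exists_sum_div_sq_le (c : ℝ) (hc : 0 ≤ c) {ε : ℝ} (hε : 0 < ε) :
    ∃ X : ℕ, ∀ x₀ ≥ X, ∀ N : ℕ, ∑ n ∈ Finset.Ico x₀ N, c / (n : ℝ) ^ 2 ≤ ε := by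
  refine ⟨⌈2 * c / ε⌉₊ + 1, fun x₀ hx N => ?_⟩
  have hx1 : 2 * c / ε ≤ x₀ :=
    (Nat.le_ceil _).trans (by exact_mod_cast (Nat.le_succ _).trans hx)
  have hx0 : (0 : ℝ) < x₀ := by
    have : 0 < x₀ := by omega
    exact_mod_cast this
  have h1 := sum_Ioo_inv_sq_le (α := ℝ) (x₀ - 1) N
  have h2 : Finset.Ioo (x₀ - 1) N = Finset.Ico x₀ N := by
    ext x; simp only [Finset.mem_Ioo, Finset.mem_Ico]; omega
  rw [h2, Nat.cast_sub (by omega), Nat.cast_one, sub_add_cancel] at h1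
  simp only [div_eq_mul_inv]
  rw [← Finset.mul_sum]
  calc c * ∑ n ∈ Finset.Ico x₀ N, ((n : ℝ) ^ 2)⁻¹ ≤ c * (2 / x₀) := by gcongr
    _ = 2 * c / x₀ := by ring
    _ ≤ ε := by
        rw [div_le_iff₀ hx0]
        rw [div_le_iff₀ hε] at hx1
        linarith

/-- The expected number of representations of `n` by `l` elements, for probabilities
proportional to `growth h x / x`. -/
theorem sum_prod_growth_le (hh : 1 ≤ h) {C : ℝ} (hC : 1 ≤ C) {l n : ℕ} (hl : 1 ≤ l)
    (hlh : l ≤ h) (hn : 3 ≤ n) :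
    ∑ t ∈ Finset.Nat.antidiagonalTuple l n, ∏ x ∈ Finset.univ.image t,
      (2 * (C * (growth h x / x))) ≤
      (h : ℝ) ^ (h + 1) * (2 * C * h) ^ h * (growth h n ^ l / n) := by
  have hn3 : (3 : ℝ) ≤ n := by exact_mod_cast hn
  have hh0 : (1 : ℝ) ≤ h := by exact_mod_cast hh
  have hl1 : (1 : ℝ) ≤ l := by exact_mod_cast hl
  have hlh' : (l : ℝ) ≤ h := by exact_mod_cast hlh
  have hG := one_le_growth (h := h) hn3
  have hCh : 1 ≤ 2 * C * h := by nlinarith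
  have hnn : ∀ x : ℕ, 0 ≤ growth h x / x := fun x =>
    div_nonneg (growth_natCast_nonneg hh x) (Nat.cast_nonneg _)
  have key := sum_antidiagonalTuple_prod_image_le hl n (fun x => 2 * (C * (growth h x / x)))
    (fun x => by have := hnn x; positivity) (2 * C * h * (growth h n / n))
    (2 * C * h * growth h n) ?_ (by positivity) (by nlinarith) ?_
  · refine key.trans ?_
    obtain ⟨k, rfl⟩ : ∃ k, l = k + 1 := ⟨l - 1, by omega⟩
    rw [Nat.add_sub_cancel]
    calc ((k + 1 : ℕ) : ℝ) ^ (k + 1) * ((k + 1 : ℕ) : ℝ) *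
          (2 * C * h * (growth h n / n) * (2 * C * h * growth h n) ^ k)
        = ((k + 1 : ℕ) : ℝ) ^ (k + 1 + 1) * (2 * C * h) ^ (k + 1) *
          (growth h n ^ (k + 1) / n) := by ring
      _ ≤ (h : ℝ) ^ (k + 1 + 1) * (2 * C * h) ^ (k + 1) * (growth h n ^ (k + 1) / n) := by
          gcongr
      _ ≤ _ := by gcongr
  · intro x hx hxn
    have hx0 : 0 < x := by
      rcases Nat.eq_zero_or_pos x with rfl | h0
      · omega
      · exact h0
    have hx1 : (1 : ℝ) ≤ x := by exact_mod_cast hx0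
    have hxn' : (x : ℝ) ≤ n := by exact_mod_cast hxn
    have hx' : (n : ℝ) ≤ l * x := by exact_mod_cast hx
    have h1 : growth h x / x ≤ h * (growth h n / n) := by
      rw [← mul_div_assoc, div_le_div_iff₀ (by linarith) (by linarith)]
      have h2 := growth_mono (h := h) hx1 hxn'
      have h3 : (n : ℝ) ≤ h * x := hx'.trans (by gcongr)
      calc growth h x * n ≤ growth h n * (h * x) := by gcongr
        _ = _ := by ring
    calc 2 * (C * (growth h x / x)) ≤ 2 * (C * (h * (growth h n / n))) := by gcongr
      _ = _ := by ring
  · rw [← Finset.mul_sum, ← Finset.mul_sum]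
    have := sum_growth_div_le hh n (by omega)
    calc _ ≤ 2 * (C * (h * growth h n)) := by gcongr
      _ = _ := by ring

end Growth

/-! ### The random construction and the Erdős–Tetali theorem -/

section Existence

variable {h : ℕ}

/-- The sampling probabilities. -/
noncomputable def samplingProb (h : ℕ) (C : ℝ) (x : ℕ) : ℝ := C * (growth h x / x)

theorem samplingProb_nonneg (hh : 1 ≤ h) {C : ℝ} (hC : 0 ≤ C) (x : ℕ) : 0 ≤ samplingProb h C x :=
  mul_nonneg hC (div_nonneg (growth_natCast_nonneg hh x) (Nat.cast_nonneg _))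

theorem eventually_samplingProb_le_one (hh : 2 ≤ h) {C : ℝ} (hC : 0 ≤ C) :
    ∀ᶠ x : ℕ in atTop, samplingProb h C x ≤ 1 := by
  filter_upwards [eventually_growth_pow_pred_div_le (by omega : 1 ≤ h) hC,
    eventually_ge_atTop 3] with x hx h3
  have h3' : (3 : ℝ) ≤ x := by exact_mod_cast h3
  have hG := one_le_growth (h := h) h3'
  have h1 : growth h x ≤ growth h x ^ (h - 1) := le_self_pow₀ hG (by omega)
  have h2 : ((x : ℝ) ^ (1 / (2 * h : ℝ)))⁻¹ ≤ 1 :=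
    inv_le_one_of_one_le₀ (Real.one_le_rpow (by linarith) (by positivity))
  calc samplingProb h C x ≤ C * (growth h x ^ (h - 1) / x) := by
        unfold samplingProb; gcongr
    _ ≤ 1 := hx.trans h2

/-- The union of two finite sets contains the supports of at least `k` representations of `n` as a
sum of `l` elements, the supports being pairwise disjoint. -/
def HasDisjointReps (l n k : ℕ) (S T : Finset ℕ) : Prop :=
  ∃ F ⊆ Finset.Nat.antidiagonalTuple l n,
    (F : Set (Fin l → ℕ)).PairwiseDisjoint (fun t => Finset.univ.image t) ∧ k ≤ F.card ∧
    ∀ t ∈ F, Finset.univ.image t ⊆ S ∪ T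

theorem repFun_succ_le_of_not_hasDisjointReps {l n K k : ℕ} {S T : Finset ℕ}
    (hk : ¬ HasDisjointReps (l + 1) n k S T)
    (hK : ∀ m ≤ n, repFun l (S ∪ T : Finset ℕ) m ≤ K) :
    repFun (l + 1) (S ∪ T : Finset ℕ) n ≤ (l + 1) * ((l + 1) * k) * K := by
  refine repFun_succ_le_of_disjoint l _ n K k hK fun F hF hd => ?_
  by_contra hcon
  refine hk ⟨F, fun t ht => ?_, hd, (not_le.1 hcon).le, fun t ht => ?_⟩
  · rw [Finset.Nat.mem_antidiagonalTuple]
    exact (mem_repTuples.1 (hF ht)).1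
  · intro x hx
    obtain ⟨i, _, rfl⟩ := Finset.mem_image.1 hx
    exact (mem_repTuples.1 (hF ht)).2 i

theorem repFun_eq_zero_of_lt {l : ℕ} (hl : 1 ≤ l) {A : Set ℕ} {x₀ n : ℕ} (hA : ∀ x ∈ A, x₀ ≤ x)
    (hn : n < x₀) : repFun l A n = 0 := by
  rw [repFun_eq_card, Finset.card_eq_zero, Finset.eq_empty_iff_forall_notMem]
  intro t ht
  rw [mem_repTuples] at ht
  have h1 := hA _ (ht.2 ⟨0, hl⟩)
  have h2 := Finset.single_le_sum (f := t) (fun _ _ => Nat.zero_le _)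
    (Finset.mem_univ (⟨0, hl⟩ : Fin l))
  omega

/-- Induction on `l`, each summand costing a factor at most h²k. The bound does not involve the
sampling constant `C`. -/
theorem repFun_le_of_not_hasDisjointReps {k x₀ N : ℕ} {S T : Finset ℕ} (hh : 1 ≤ h)
    (hS : ∀ x ∈ S ∪ T, x₀ ≤ x)
    (hk : ∀ n ∈ Finset.Ico x₀ N, ∀ l ∈ Finset.range (h - 1), ¬ HasDisjointReps (l + 1) n k S T)
    (l : ℕ) (hl : l ≤ h - 1) (n : ℕ) (hn : n < N) :
    repFun l (S ∪ T : Finset ℕ) n ≤ (h * (h * k)) ^ l := by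
  induction l generalizing n with
  | zero => simpa using repFun_zero_le _ n
  | succ l ih =>
    by_cases hnx : n < x₀
    · rw [repFun_eq_zero_of_lt (by omega) (fun x hx => hS x (by exact_mod_cast hx)) hnx]
      exact Nat.zero_le _
    · refine (repFun_succ_le_of_not_hasDisjointReps
        (hk n (Finset.mem_Ico.2 ⟨not_lt.1 hnx, hn⟩) l (Finset.mem_range.2 (by omega)))
        fun m hm => ih (by omega) m (by omega)).trans ?_
      rw [pow_succ, mul_comm _ (h * (h * k))]
      gcongr <;> omega

theorem pairProb_hasDisjointReps_lt_le (hh : 1 ≤ h) {C : ℝ} (hC : 1 ≤ C) {V : Finset ℕ}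
    (hV : ∀ x ∈ V, samplingProb h C x ≤ 1) {l n : ℕ} (hl : 1 ≤ l) (hlh : l < h) (hn : 3 ≤ n)
    (hnl : (h : ℝ) ^ (h + 1) * (2 * C * h) ^ h * (growth h n ^ (h - 1) / n) ≤
      ((n : ℝ) ^ (1 / (2 * h : ℝ)))⁻¹) :
    pairProb V (samplingProb h C) (HasDisjointReps l n (4 * h)) ≤ 3 / (n : ℝ) ^ 2 := by
  have hn3 : (3 : ℝ) ≤ n := by exact_mod_cast hn
  have hn0 : (0 : ℝ) < n := by linarith
  have hh0 : (0 : ℝ) < h := by exact_mod_cast hh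
  have hG := one_le_growth (h := h) hn3
  have hp0 := samplingProb_nonneg hh (C := C) (by linarith)
  set z := (n : ℝ) ^ (1 / (2 * h : ℝ)) with hz
  have hz1 : 1 ≤ z := Real.one_le_rpow (by linarith) (by positivity)
  -- The choice z = n^(1/(2h)) balances both factors: `4 * h` disjoint supports gain n^(-2), while
  -- zμ ≤ 1 in the exponential.
  have hzk : z ^ (4 * h) = (n : ℝ) ^ 2 := by
    rw [hz, ← Real.rpow_natCast, ← Real.rpow_mul hn0.le, ← Real.rpow_natCast]
    congr 1
    push_cast
    field_simp
    norm_num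
  have hμ := (sum_prod_growth_le hh hC hl hlh.le hn).trans (le_trans (b :=
    (h : ℝ) ^ (h + 1) * (2 * C * h) ^ h * (growth h n ^ (h - 1) / n)) (by
      have : growth h n ^ l ≤ growth h n ^ (h - 1) := pow_le_pow_right₀ hG (by omega)
      gcongr) hnl)
  refine (pairProb_disjoint_family_le (fun x hx => ⟨hp0 x, hV x hx⟩) hp0 _ _ (4 * h) z z⁻¹ hz1
    hμ).trans ?_
  rw [hzk, mul_inv_cancel₀ (by positivity), div_eq_inv_mul]
  exact mul_le_mul_of_nonneg_left Real.exp_one_lt_three.le (by positivity)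

theorem exp_neg_two_mul_log {n : ℕ} (hn : 1 ≤ n) :
    Real.exp (-(2 * Real.log n)) = 1 / (n : ℝ) ^ 2 := by
  have hn0 : (0 : ℝ) < n := by exact_mod_cast hn
  rw [Real.exp_neg, mul_comm, Real.exp_mul, Real.exp_log hn0, one_div]
  norm_cast

theorem pairProb_hasDisjointReps_self_le (hh : 1 ≤ h) {C : ℝ} (hC : 1 ≤ C) {V : Finset ℕ}
    (hV : ∀ x ∈ V, samplingProb h C x ≤ 1) {n k : ℕ} (hn : 3 ≤ n)
    (hk : (3 * ((h : ℝ) ^ (h + 1) * (2 * C * h) ^ h) + 2) * Real.log n ≤ k) :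
    pairProb V (samplingProb h C) (HasDisjointReps h n k) ≤ 1 / (n : ℝ) ^ 2 := by
  have hn3 : (3 : ℝ) ≤ n := by exact_mod_cast hn
  have hn0 : (0 : ℝ) < n := by linarith
  have hp0 := samplingProb_nonneg hh (C := C) (by linarith)
  have hμ := sum_prod_growth_le hh hC hh le_rfl hn
  rw [growth_pow hh (by linarith), mul_div_cancel_left₀ _ hn0.ne'] at hμ
  -- With z = e the bound is exp(eμ - k), and e < 3 explains the coefficient 3 in `hk`; the extra 2
  -- log n gives n^(-2).
  refine (pairProb_disjoint_family_le (fun x hx => ⟨hp0 x, hV x hx⟩) hp0 _ _ k (Real.exp 1) _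
    (Real.one_le_exp zero_le_one) hμ).trans ?_
  have hlog := one_le_log_of_three_le hn3
  rw [← exp_neg_two_mul_log (by omega), ← Real.exp_nat_mul, mul_one, ← Real.exp_neg, ← Real.exp_add]
  apply Real.exp_le_exp.2
  have he := Real.exp_one_lt_three
  have hD : 0 ≤ (h : ℝ) ^ (h + 1) * (2 * C * h) ^ h * Real.log n := by positivity
  nlinarith

theorem growth_div_le_samplingProb (hh : 1 ≤ h) {C D : ℝ} (hC : 0 ≤ C) (hD : 1 ≤ D) {n a m : ℕ}
    (hn : D ^ 2 ≤ n) (ha : (n : ℝ) / D ≤ a) (ham : a ≤ m) :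
    C * growth h n / (2 * D * m) ≤ samplingProb h C a := by
  have hD0 : 0 < D := by linarith
  have hn0 : (0 : ℝ) < n := lt_of_lt_of_le (by positivity) hn
  have ha0 : (0 : ℝ) < a := lt_of_lt_of_le (by positivity) ha
  have ham' : (a : ℝ) ≤ m := by exact_mod_cast ham
  have hm0 : (0 : ℝ) < m := ha0.trans_le ham'
  have h1 := growth_le_of_div_le hh hD hn ha
  have h2 := growth_natCast_nonneg hh a
  unfold samplingProb
  rw [mul_div_assoc]
  refine mul_le_mul_of_nonneg_left ?_ hC
  rw [div_le_div_iff₀ (by positivity) ha0]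
  calc growth h n * a ≤ (2 * D * growth h a) * m := by gcongr
    _ = _ := by ring

theorem sum_samplingProb_ge (hh : 1 ≤ h) {C : ℝ} (hC : 0 ≤ C) {x₀ N n m : ℕ}
    (hm : m = n / (2 * h)) (hn : 64 * h ^ 2 * (x₀ + 1) ≤ n) (hN : n < N) :
    C * growth h n / (32 * h) ≤
      ∑ a ∈ Finset.Ico x₀ N, samplingProb h C a * ((if a ≤ m then 1 else 0 : ℕ) : ℝ) := by
  have hh0 : (1 : ℝ) ≤ h := by exact_mod_cast hh
  have hp0 := samplingProb_nonneg hh hC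
  have hm1 : 32 * h * (x₀ + 1) ≤ m := by
    rw [hm, Nat.le_div_iff_mul_le (by omega)]
    calc _ = 64 * h ^ 2 * (x₀ + 1) := by ring
      _ ≤ n := hn
  have hmx : 2 * x₀ + 2 ≤ m := le_trans (by nlinarith) hm1
  have hmn : m ≤ n := hm ▸ Nat.div_le_self _ _
  have hnm : n < 2 * h * (m + 1) := by
    rw [hm]; exact Nat.lt_mul_div_succ n (by omega)
  have hm0 : (0 : ℝ) < m := by
    have : 0 < m := by omega
    exact_mod_cast this
  have hn' : (8 * h : ℝ) ^ 2 ≤ n := by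
    have : 64 * h ^ 2 * 1 ≤ n := le_trans (Nat.mul_le_mul_left _ (by omega)) hn
    calc (8 * h : ℝ) ^ 2 = ((64 * h ^ 2 * 1 : ℕ) : ℝ) := by push_cast; ring
      _ ≤ n := by exact_mod_cast this
  calc C * growth h n / (32 * h) = (m / 2) * (C * growth h n / (2 * (8 * h) * m)) := by
        field_simp; ring
    _ ≤ ((Finset.Ioc (m / 2) m).card : ℝ) * (C * growth h n / (2 * (8 * h) * m)) := by
        have := growth_natCast_nonneg hh n
        refine mul_le_mul_of_nonneg_right ?_ (by positivity)
        rw [Nat.card_Ioc, div_le_iff₀ (by norm_num)]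
        have : m ≤ (m - m / 2) * 2 := by omega
        exact_mod_cast this
    _ ≤ ∑ a ∈ Finset.Ioc (m / 2) m,
          samplingProb h C a * ((if a ≤ m then 1 else 0 : ℕ) : ℝ) := by
        rw [← nsmul_eq_mul]
        refine Finset.card_nsmul_le_sum _ _ _ fun a ha => ?_
        rw [Finset.mem_Ioc] at ha
        rw [if_pos ha.2, Nat.cast_one, mul_one]
        -- In the upper half of [0, m] one has n < 2h(m+1) ≤ 4ha, so D = 8h leaves room to spare.
        refine growth_div_le_samplingProb hh hC (by linarith) hn' ?_ ha.2
        rw [div_le_iff₀ (by positivity)]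
        have : n ≤ a * (8 * h) := by
          have h1 : m + 1 ≤ 2 * a := by omega
          nlinarith
        exact_mod_cast this
    _ ≤ _ := by
        refine Finset.sum_le_sum_of_subset_of_nonneg (fun a ha => ?_)
          fun a _ _ => mul_nonneg (hp0 a) (Nat.cast_nonneg _)
        rw [Finset.mem_Ioc] at ha
        exact Finset.mem_Ico.2 (by omega)

/-- The tail bound for the counting function of a random set. -/
theorem pairProb_countUpTo_le (hh : 1 ≤ h) {C : ℝ} (hC : 1 ≤ C) {x₀ N n : ℕ}
    (hV : ∀ x ∈ Finset.Ico x₀ N, samplingProb h C x ≤ 1)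
    (hn : 64 * h ^ 2 * (x₀ + 1) ≤ n) (hN : n < N) (hlog : 256 * h * Real.log n ≤ growth h n) :
    pairProb (Finset.Ico x₀ N) (samplingProb h C)
      (fun S _ => (countUpTo S (n / (2 * h)) : ℝ) ≤ C * growth h n / (128 * h))
      ≤ 1 / (n : ℝ) ^ 2 := by
  classical
  have hh0 : (1 : ℝ) ≤ h := by exact_mod_cast hh
  have hp : ∀ x ∈ Finset.Ico x₀ N, 0 ≤ samplingProb h C x ∧ samplingProb h C x ≤ 1 :=
    fun x hx => ⟨samplingProb_nonneg hh (by linarith) x, hV x hx⟩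
  have hn1 : 1 ≤ n := le_trans (Nat.mul_pos (Nat.mul_pos (by norm_num) (by positivity))
    (Nat.succ_pos _)) hn
  set m := n / (2 * h) with hm
  set w : ℕ → ℕ := fun a => if a ≤ m then 1 else 0 with hw
  have hcount : ∀ S : Finset ℕ, countUpTo S m = ∑ a ∈ S, w a := by
    intro S
    rw [countUpTo, hw, ← Finset.sum_filter, ← Finset.card_eq_sum_ones]
    congr 1
    ext a
    simp only [Finset.mem_filter, Finset.mem_range, Finset.mem_coe]
    exact ⟨fun H => ⟨H.2, Nat.le_of_lt_succ H.1⟩, fun H => ⟨Nat.lt_succ_of_le H.2, H.1⟩⟩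
  have key := bernoulliMean_lower_tail hp w 1 (C * growth h n / (128 * h)) _ le_rfl
    (fun a _ => by simp only [w]; split_ifs <;> simp)
    (sum_samplingProb_ge hh (by linarith) hm hn hN)
  rw [← exp_neg_two_mul_log hn1]
  refine le_trans ?_ (key.trans (Real.exp_le_exp.2 ?_))
  · refine bernoulliMean_mono hp fun S _ => ?_
    rw [bernoulliMean_const, hcount]
  · have h1 : C * growth h n / (128 * h) - C * growth h n / (32 * h) / (2 * 1)
        = -(C * growth h n / (128 * h)) := by field_simp; ring
    rw [h1, neg_le_neg_iff, le_div_iff₀ (by positivity)]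
    have := Real.log_nonneg (x := n) (by exact_mod_cast hn1)
    have := growth_natCast_nonneg hh n
    nlinarith

/-- The tail bound for the number of representations. -/
theorem pairProb_sum_repFun_le (hh : 2 ≤ h) {C K : ℝ} (hK : 1 ≤ K) (hC : C = 24 * K * (128 * h))
    {x₀ N n : ℕ} (hV : ∀ x ∈ Finset.Ico x₀ N, samplingProb h C x ≤ 1)
    (hn : 64 * h ^ 2 * (x₀ + 1) ≤ n) (hN : n < N) :
    pairProb (Finset.Ico x₀ N) (samplingProb h C)
      (fun S T => (∀ b ≤ n, (repFun (h - 1) S b : ℝ) ≤ K) ∧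
        C * growth h n / (128 * h) < countUpTo S (n / (2 * h)) ∧
        ((∑ a ∈ T, if a ≤ n then repFun (h - 1) S (n - a) else 0 : ℕ) : ℝ) ≤ Real.log n)
      ≤ 1 / (n : ℝ) ^ 2 := by
  classical
  have hh0 : (2 : ℝ) ≤ h := by exact_mod_cast hh
  have hC0 : 0 ≤ C := by rw [hC]; positivity
  have hp : ∀ x ∈ Finset.Ico x₀ N, 0 ≤ samplingProb h C x ∧ samplingProb h C x ≤ 1 :=
    fun x hx => ⟨samplingProb_nonneg (by omega) hC0 x, hV x hx⟩
  have hn64 : 64 * (x₀ + 1) ≤ n :=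
    le_trans (Nat.mul_le_mul_right _ (Nat.le_mul_of_pos_right _ (by positivity))) hn
  have hn1 : 1 ≤ n := by omega
  have hn0 : (1 : ℝ) ≤ n := by exact_mod_cast hn1
  have hlog := Real.log_nonneg hn0
  have hG := growth_nonneg (h := h) hn0
  set m := n / (2 * h) with hm
  rw [← exp_neg_two_mul_log hn1]
  refine pairProb_le_of_forall hp fun S _ => ?_
  -- The first two conditions concern `S` alone: if they fail, the event is empty, and if they hold,
  -- only `T` remains random.
  by_cases hS : (∀ b ≤ n, (repFun (h - 1) S b : ℝ) ≤ K) ∧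
      C * growth h n / (128 * h) < countUpTo S m
  swap
  · refine (bernoulliMean_mono hp (F' := fun _ => 0) fun T _ => ?_).trans
      ((bernoulliMean_const 0).trans_le (Real.exp_pos _).le)
    split_ifs with hT
    · exact absurd ⟨hT.1, hT.2.1⟩ hS
    · exact le_rfl
  obtain ⟨hS1, hS2⟩ := hS
  set w : ℕ → ℕ := fun a => if a ≤ n then repFun (h - 1) S (n - a) else 0 with hw
  -- Sums `b` of h-1 elements of `S` up to `m` are at most n/2, so the remaining summand n - b lies
  -- in [n/2, n], where the sampling probability is ≫ f(n)/n.
  have hM : 2 * ((h - 1) * m) ≤ n := by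
    have h1 : 2 * h * m ≤ n := hm ▸ Nat.mul_div_le n (2 * h)
    refine le_trans ?_ h1
    rw [← mul_assoc]
    gcongr
    omega
  have hsum : C ^ h * Real.log n / (4 * (128 * h) ^ h) ≤
      ∑ a ∈ Finset.Ico x₀ N, samplingProb h C a * w a := by
    obtain ⟨k, rfl⟩ : ∃ k, h = k + 1 := ⟨h - 1, by omega⟩
    rw [Nat.add_sub_cancel] at hM
    set R : ℝ := 128 * ((k + 1 : ℕ) : ℝ) with hR
    have hR1 : 1 ≤ R := by rw [hR]; linarith
    calc C ^ (k + 1) * Real.log n / (4 * R ^ (k + 1))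
        ≤ C ^ (k + 1) * Real.log n / (4 * R ^ k) := by
          gcongr
          omega
      _ = C * growth (k + 1) n / (2 * 2 * n) * (C * growth (k + 1) n / R) ^ k := by
          have h1 := growth_pow (h := k + 1) (by omega) hn0
          have h2 : Real.log n = growth (k + 1) n ^ (k + 1) / n := by
            rw [h1, mul_div_cancel_left₀]; positivity
          have hR0 : R ≠ 0 := by linarith
          have hn0' : (n : ℝ) ≠ 0 := by linarith
          rw [h2, div_pow, mul_pow]
          field_simp
          ring
      _ ≤ C * growth (k + 1) n / (2 * 2 * n) * (countUpTo S m : ℝ) ^ k := by gcongr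
      _ ≤ C * growth (k + 1) n / (2 * 2 * n) *
            ∑ b ∈ Finset.range (k * m + 1), (repFun k S b : ℝ) := by
          refine mul_le_mul_of_nonneg_left ?_ (by positivity)
          exact_mod_cast pow_le_sum_repFun k S m
      _ ≤ ∑ b ∈ Finset.range (k * m + 1), samplingProb (k + 1) C (n - b : ℕ) * w (n - b) := by
          rw [Finset.mul_sum]
          refine Finset.sum_le_sum fun b hb => ?_
          rw [Finset.mem_range] at hb
          have hwb : w (n - b) = repFun k S b := by
            simp only [w]
            rw [if_pos (Nat.sub_le _ _), Nat.sub_sub_self (by omega), Nat.add_sub_cancel]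
          rw [hwb]
          refine mul_le_mul_of_nonneg_right ?_ (Nat.cast_nonneg _)
          refine growth_div_le_samplingProb (by omega) hC0 (by norm_num) ?_ ?_ (Nat.sub_le _ _)
          · have : 4 ≤ n := by omega
            have : (4 : ℝ) ≤ n := by exact_mod_cast this
            linarith
          · rw [div_le_iff₀ (by norm_num)]
            have : n ≤ (n - b) * 2 := by omega
            exact_mod_cast this
      _ = ∑ a ∈ (Finset.range (k * m + 1)).image (fun b => n - b),
            samplingProb (k + 1) C a * w a := by
          rw [Finset.sum_image]
          intro b hb b' hb' hbb
          simp only [Finset.coe_range, Set.mem_Iio] at hb hb' hbb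
          omega
      _ ≤ _ := by
          refine Finset.sum_le_sum_of_subset_of_nonneg (fun a ha => ?_)
            fun a ha _ => mul_nonneg (hp a ha).1 (Nat.cast_nonneg _)
          obtain ⟨b, hb, rfl⟩ := Finset.mem_image.1 ha
          rw [Finset.mem_range] at hb
          exact Finset.mem_Ico.2 (by omega)
  have key := bernoulliMean_lower_tail hp w K (Real.log n) _ hK (fun a _ => by
    simp only [w]
    split_ifs
    · exact hS1 _ (Nat.sub_le _ _)
    · simp only [Nat.cast_zero]; linarith) hsum
  refine le_trans (bernoulliMean_mono hp fun T _ => ?_) (key.trans (Real.exp_le_exp.2 ?_))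
  · by_cases hT : ((∑ a ∈ T, w a : ℕ) : ℝ) ≤ Real.log n
    · rw [if_pos hT]; split_ifs <;> norm_num
    · rw [if_neg hT, if_neg fun hT' => hT hT'.2.2]
  · have h1 : C ^ h * Real.log n / (4 * (128 * h) ^ h) / (2 * K) =
        (24 * K) ^ h * Real.log n / (8 * K) := by
      rw [hC, mul_pow]
      field_simp
      ring
    -- The factor 24 makes the negative term at least 24K/(8K) · log n = 3 log n, leaving exp(-2 log
    -- n) after the threshold log n is added.
    have h2 : 24 * K ≤ (24 * K) ^ h := le_self_pow₀ (by linarith) (by omega)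
    have h3 : 3 * Real.log n ≤ (24 * K) ^ h * Real.log n / (8 * K) := by
      rw [le_div_iff₀ (by positivity)]
      calc 3 * Real.log n * (8 * K) = 24 * K * Real.log n := by ring
        _ ≤ _ := by gcongr
    rw [h1]
    linarith

theorem sum_repFun_le_repFun_union (hh : 1 ≤ h) (S T : Finset ℕ) (n : ℕ) :
    ∑ a ∈ T, (if a ≤ n then repFun (h - 1) S (n - a) else 0) ≤
      repFun h (S ∪ T : Finset ℕ) n := by
  classical
  obtain ⟨k, rfl⟩ : ∃ k, h = k + 1 := ⟨h - 1, by omega⟩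
  rw [repFun_succ, Nat.add_sub_cancel, ← Finset.sum_filter]
  refine le_trans (Finset.sum_le_sum fun a ha => ?_) (Finset.sum_le_sum_of_subset
    (s := T.filter (· ≤ n)) fun a ha => ?_)
  · have haT : a ∈ ((S ∪ T : Finset ℕ) : Set ℕ) := by simp [(Finset.mem_filter.1 ha).1]
    rw [if_pos haT]
    exact repFun_mono k (by simp) _
  · exact Finset.mem_range.2 (Nat.lt_succ_of_le (Finset.mem_filter.1 ha).2)

/-- The constants `c` and `n₀` are uniform in `N`, as the later limit over windows requires. -/
theorem exists_forall_lt_repFun_bounds (hh : 2 ≤ h) :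
    ∃ (c : ℝ) (n₀ : ℕ), ∀ N : ℕ, ∃ B : Set ℕ, ∀ n, n₀ ≤ n → n < N →
      Real.log n ≤ repFun h B n ∧ (repFun h B n : ℝ) ≤ c * Real.log n := by
  have hh1 : 1 ≤ h := by omega
  have hh2 : (2 : ℝ) ≤ h := by exact_mod_cast hh
  set K : ℕ := (h * (h * (4 * h))) ^ (h - 1) with hKdef
  have hK1 : (1 : ℝ) ≤ K := by
    have : 1 ≤ K := Nat.one_le_iff_ne_zero.2 (by positivity)
    exact_mod_cast this
  -- `K` depends on `h` only, so there is no circularity; the thresholds `x₀` and `n₀` are chosen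
  -- after `C`.
  set C : ℝ := 24 * K * (128 * h) with hC
  have hC1 : 1 ≤ C := by rw [hC]; nlinarith
  set D : ℝ := (h : ℝ) ^ (h + 1) * (2 * C * h) ^ h with hD
  have hD0 : 0 ≤ D := by positivity
  -- The upper and lower bad events get total probability at most 1/4 each. Per `n`, the upper ones
  -- cost 3/n² for each of the h-1 small orders and 1/n² for order `h`.
  obtain ⟨X, hX⟩ := exists_sum_div_sq_le (3 * h + 1) (by positivity) (ε := 1 / 4) (by norm_num)
  obtain ⟨X', hX'⟩ := eventually_atTop.1 ((eventually_samplingProb_le_one hh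
    (C := C) (by linarith)).and (eventually_growth_pow_pred_div_le hh1 hD0))
  set x₀ := max 3 (max X X') with hx₀
  have hx3 : 3 ≤ x₀ := le_max_left _ _
  have hxX : X ≤ x₀ := (le_max_left _ _).trans (le_max_right _ _)
  have hxX' : X' ≤ x₀ := (le_max_right _ _).trans (le_max_right _ _)
  obtain ⟨Y, hY⟩ := eventually_atTop.1 (eventually_mul_log_le_growth hh1 (256 * h))
  set n₀ := max Y (64 * h ^ 2 * (x₀ + 1)) with hn₀
  have hn₀Y : Y ≤ n₀ := le_max_left _ _
  have hn₀x : 64 * h ^ 2 * (x₀ + 1) ≤ n₀ := le_max_right _ _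
  have hx₀n₀ : x₀ ≤ n₀ := by
    refine le_trans ?_ hn₀x
    have : 1 ≤ 64 * h ^ 2 := Nat.one_le_iff_ne_zero.2 (by positivity)
    nlinarith
  let k : ℕ → ℕ := fun n => ⌈(3 * D + 2) * Real.log n⌉₊
  refine ⟨h * h * (3 * D + 3) * K, n₀, fun N => ?_⟩
  set V := Finset.Ico x₀ N with hVdef
  have hV : ∀ x ∈ V, samplingProb h C x ≤ 1 := fun x hx =>
    (hX' x (hxX'.trans (Finset.mem_Ico.1 hx).1)).1
  have hp : ∀ x ∈ V, 0 ≤ samplingProb h C x ∧ samplingProb h C x ≤ 1 :=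
    fun x hx => ⟨samplingProb_nonneg hh1 (by linarith) x, hV x hx⟩
  let Φ₁ : ℕ → Finset ℕ → Finset ℕ → Prop := fun n S T =>
    (∃ l ∈ Finset.range (h - 1), HasDisjointReps (l + 1) n (4 * h) S T) ∨
      HasDisjointReps h n (k n) S T
  let Φ₂ : ℕ → Finset ℕ → Finset ℕ → Prop := fun n S T =>
    ((countUpTo S (n / (2 * h)) : ℝ) ≤ C * growth h n / (128 * h)) ∨
    ((∀ b ≤ n, (repFun (h - 1) S b : ℝ) ≤ K) ∧
        C * growth h n / (128 * h) < countUpTo S (n / (2 * h)) ∧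
        ((∑ a ∈ T, if a ≤ n then repFun (h - 1) S (n - a) else 0 : ℕ) : ℝ) ≤ Real.log n)
  have h1 : ∀ n ∈ Finset.Ico x₀ N,
      pairProb V (samplingProb h C) (Φ₁ n) ≤ (3 * h + 1) / (n : ℝ) ^ 2 := by
    intro n hn
    rw [Finset.mem_Ico] at hn
    have hn3 : 3 ≤ n := hx3.trans hn.1
    have ha : pairProb V (samplingProb h C)
        (fun S T => ∃ l ∈ Finset.range (h - 1), HasDisjointReps (l + 1) n (4 * h) S T) ≤
        (h : ℝ) * (3 / (n : ℝ) ^ 2) := by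
      refine (pairProb_exists_le hp _ _).trans ?_
      refine (Finset.sum_le_card_nsmul _ _ (3 / (n : ℝ) ^ 2) fun l hl => ?_).trans ?_
      · exact pairProb_hasDisjointReps_lt_le hh1 hC1 hV (by omega)
          (by have := Finset.mem_range.1 hl; omega) hn3 (hX' n (hxX'.trans hn.1)).2
      · rw [nsmul_eq_mul, Finset.card_range]
        gcongr
        exact Nat.sub_le _ _
    have hb := pairProb_hasDisjointReps_self_le hh1 hC1 hV hn3
      (Nat.le_ceil ((3 * D + 2) * Real.log n))
    refine (pairProb_or_le hp _ _).trans ((add_le_add ha hb).trans (le_of_eq ?_))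
    ring
  have h2 : ∀ n ∈ Finset.Ico n₀ N,
      pairProb V (samplingProb h C) (Φ₂ n) ≤ (3 * h + 1) / (n : ℝ) ^ 2 := by
    intro n hn
    rw [Finset.mem_Ico] at hn
    refine (pairProb_or_le hp _ _).trans ((add_le_add
      (pairProb_countUpTo_le hh1 hC1 hV (hn₀x.trans hn.1) hn.2 (hY n (hn₀Y.trans hn.1)))
      (pairProb_sum_repFun_le hh hK1 hC hV (hn₀x.trans hn.1) hn.2)).trans ?_)
    rw [← add_div]
    gcongr
    linarith
  obtain ⟨S, T, hS, hT, hST⟩ := exists_not_of_pairProb_lt_one hp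
    (Φ := fun S T => (∃ n ∈ Finset.Ico x₀ N, Φ₁ n S T) ∨ ∃ n ∈ Finset.Ico n₀ N, Φ₂ n S T) (by
      refine (pairProb_or_le hp _ _).trans_lt ?_
      have e1 := (pairProb_exists_le hp (Finset.Ico x₀ N) Φ₁).trans
        ((Finset.sum_le_sum h1).trans (hX x₀ hxX N))
      have e2 := (pairProb_exists_le hp (Finset.Ico n₀ N) Φ₂).trans
        ((Finset.sum_le_sum h2).trans (hX n₀ (hxX.trans hx₀n₀) N))
      linarith)
  push Not at hST
  obtain ⟨hg1, hg2⟩ := hST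
  have hrep : ∀ n < N, repFun (h - 1) (S ∪ T : Finset ℕ) n ≤ K := fun n hn =>
    repFun_le_of_not_hasDisjointReps (k := 4 * h) hh1
      (fun x hx => (Finset.mem_Ico.1 (Finset.union_subset hS hT hx)).1)
      (fun n hn l hl hd => hg1 n hn (Or.inl ⟨l, hl, hd⟩)) (h - 1) le_rfl n hn
  refine ⟨(S ∪ T : Finset ℕ), fun n hn hnN => ⟨?_, ?_⟩⟩
  · have hΦ := hg2 n (Finset.mem_Ico.2 ⟨hn, hnN⟩)
    simp only [Φ₂, not_or, not_and, not_le] at hΦ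
    have hb : ∀ b ≤ n, (repFun (h - 1) S b : ℝ) ≤ K := fun b hb => by
      have := (repFun_mono (h - 1) (A := S) (A' := (S ∪ T : Finset ℕ)) (by simp) b).trans
        (hrep b (by omega))
      exact_mod_cast this
    refine (hΦ.2 hb hΦ.1).le.trans ?_
    exact_mod_cast sum_repFun_le_repFun_union hh1 S T n
  · have hΦ := hg1 n (Finset.mem_Ico.2 ⟨hx₀n₀.trans hn, hnN⟩)
    have hd : ¬ HasDisjointReps (h - 1 + 1) n (k n) S T := by
      rw [Nat.sub_add_cancel hh1]
      exact fun hd => hΦ (Or.inr hd)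
    have hle := repFun_succ_le_of_not_hasDisjointReps hd fun m hm => hrep m (by omega)
    rw [Nat.sub_add_cancel hh1] at hle
    have hlog : 1 ≤ Real.log n :=
      one_le_log_of_three_le (by exact_mod_cast hx3.trans (hx₀n₀.trans hn))
    have hk : (k n : ℝ) ≤ (3 * D + 3) * Real.log n := by
      have := (Nat.ceil_lt_add_one (a := (3 * D + 2) * Real.log n) (by positivity)).le
      simp only [k]
      linarith
    calc (repFun h (S ∪ T : Finset ℕ) n : ℝ) ≤ h * (h * k n) * K := by exact_mod_cast hle
      _ ≤ h * (h * ((3 * D + 3) * Real.log n)) * K := by gcongr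
      _ = _ := by ring

/-- The Erdős–Tetali theorem. -/
theorem exists_repFun_bounds (hh : 2 ≤ h) :
    ∃ (B : Set ℕ) (c : ℝ) (n₀ : ℕ), ∀ n ≥ n₀,
      Real.log n ≤ repFun h B n ∧ (repFun h B n : ℝ) ≤ c * Real.log n := by
  obtain ⟨c, n₀, H⟩ := exists_forall_lt_repFun_bounds hh
  choose B hB using H
  refine ⟨{x | ∀ᶠ N in (hyperfilter ℕ : Filter ℕ), x ∈ B N}, c, n₀, fun n hn => ?_⟩
  -- Only membership of the finitely many x ≤ n affects r_h(n), so the limit set agrees there with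
  -- `B N` for almost all `N`, including some N > n.
  have h1 : ∀ᶠ N in (hyperfilter ℕ : Filter ℕ), ∀ x ∈ Finset.range (n + 1),
      (x ∈ {x | ∀ᶠ N in (hyperfilter ℕ : Filter ℕ), x ∈ B N} ↔ x ∈ B N) := by
    rw [Filter.eventually_all_finset]
    intro x _
    by_cases hx : ∀ᶠ N in (hyperfilter ℕ : Filter ℕ), x ∈ B N
    · filter_upwards [hx] with N hN
      exact ⟨fun _ => hN, fun _ => hx⟩
    · have hx' := Ultrafilter.eventually_not.2 hx
      filter_upwards [hx'] with N hN
      exact ⟨fun h => absurd h hx, fun h => absurd h hN⟩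
  have h2 : ∀ᶠ N in (hyperfilter ℕ : Filter ℕ), n < N :=
    Nat.hyperfilter_le_atTop (eventually_gt_atTop n)
  obtain ⟨N, hN1, hN2⟩ := (h1.and h2).exists
  rw [repFun_congr h n fun x hx => hN1 x (Finset.mem_range.2 (by omega))]
  exact hB N n hn hN2

end Existence

/-! ### From r_h(n) ≍ log n to all larger numbers of summands -/

section Regularity

variable {h : ℕ}

theorem log_le_two_mul_log_of_div_le {D n x : ℝ} (hD : 1 ≤ D) (hn : D ^ 2 ≤ n)
    (hx : n / D ≤ x) : Real.log n ≤ 2 * Real.log x := by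
  have hn1 : 1 ≤ n := le_trans (one_le_pow₀ hD) hn
  have h1 : n ≤ x * D := (div_le_iff₀ (by linarith)).1 hx
  have h2 : D ≤ x := le_trans (by rw [le_div_iff₀ (by linarith)]; nlinarith) hx
  have := Real.log_le_log (by linarith) (show n ≤ x ^ 2 by nlinarith)
  rwa [Real.log_pow] at this

theorem hasDerivAt_growth {x : ℝ} (hx : 1 < x) :
    HasDerivAt (growth h) (1 / h * (growth h x / x) * (1 + 1 / Real.log x)) x := by
  have hx0 : x ≠ 0 := by linarith
  have hlog : Real.log x ≠ 0 := (Real.log_pos hx).ne'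
  have h1 := ((hasDerivAt_id x).rpow_const (p := 1 / (h : ℝ)) (Or.inl hx0)).mul
    ((Real.hasDerivAt_log hx0).rpow_const (p := 1 / (h : ℝ)) (Or.inl hlog))
  refine h1.congr_deriv ?_
  simp only [id]
  rw [Real.rpow_sub_one hx0, Real.rpow_sub_one hlog, growth]
  field_simp

theorem deriv_growth_mul_pow (hh : 1 ≤ h) (j : ℕ) {x : ℝ} (hx : 1 < x) :
    deriv (growth h) x * growth h x ^ (h + j - 1) =
      1 / h * (1 + 1 / Real.log x) * (Real.log x * growth h x ^ j) := by
  rw [(hasDerivAt_growth hx).deriv]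
  have hpow := growth_pow hh hx.le
  obtain ⟨k, rfl⟩ : ∃ k, h = k + 1 := ⟨h - 1, by omega⟩
  have hlog : Real.log x = growth (k + 1) x ^ (k + 1) / x := by
    rw [hpow, mul_div_cancel_left₀ _ (by linarith)]
  have hexp : k + 1 + j - 1 = k + j := by omega
  rw [hexp]
  calc _ = 1 / ((k + 1 : ℕ) : ℝ) * (1 + 1 / Real.log x) *
        (growth (k + 1) x ^ (k + 1) / x * growth (k + 1) x ^ j) := by ring
    _ = _ := by rw [← hlog]

theorem countUpTo_mono (A : Set ℕ) {m n : ℕ} (hmn : m ≤ n) : countUpTo A m ≤ countUpTo A n := by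
  classical
  exact Finset.card_le_card (Finset.filter_subset_filter _
    (Finset.range_subset_range.2 (by omega)))

theorem repFun_succ_le_countUpTo_mul (d : ℕ) (A : Set ℕ) {m : ℕ} {c : ℝ}
    (hc : ∀ b ≤ m, (repFun d A b : ℝ) ≤ c) :
    (repFun (d + 1) A m : ℝ) ≤ countUpTo A m * c := by
  classical
  rw [repFun_succ, ← Finset.sum_filter, countUpTo, ← nsmul_eq_mul, Nat.cast_sum]
  exact Finset.sum_le_card_nsmul _ _ _ fun a _ => hc _ (Nat.sub_le _ _)

theorem countUpTo_mul_le_repFun_succ (d : ℕ) (A : Set ℕ) {m n : ℕ} (hmn : m ≤ n) {c : ℝ}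
    (hc : ∀ a ≤ m, c ≤ repFun d A (n - a)) :
    countUpTo A m * c ≤ repFun (d + 1) A n := by
  classical
  rw [repFun_succ, ← Finset.sum_filter, countUpTo, ← nsmul_eq_mul, Nat.cast_sum]
  refine (Finset.card_nsmul_le_sum _ (fun a => (repFun d A (n - a) : ℝ)) c fun a ha => hc a ?_).trans
    (Finset.sum_le_sum_of_subset_of_nonneg (Finset.filter_subset_filter _
      (Finset.range_subset_range.2 (by omega))) fun _ _ _ => Nat.cast_nonneg _)
  have := Finset.mem_range.1 (Finset.mem_filter.1 ha).1
  omega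

variable {B : Set ℕ} {c : ℝ} {n₀ : ℕ}

theorem exists_eventually_repFun_le_log (hB : ∀ n ≥ n₀, (repFun h B n : ℝ) ≤ c * Real.log n) :
    ∃ C ≥ 1, ∀ᶠ n : ℕ in atTop, ∀ m ≤ n, (repFun h B m : ℝ) ≤ C * Real.log n := by
  refine ⟨|c| + (n₀ + 1) ^ h, ?_, ?_⟩
  · have : (1 : ℝ) ≤ (n₀ + 1) ^ h := one_le_pow₀ (by linarith [Nat.cast_nonneg (α := ℝ) n₀])
    linarith [abs_nonneg c]
  filter_upwards [eventually_ge_atTop 3] with n hn m hm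
  have hlog := one_le_log_of_three_le (x := n) (by exact_mod_cast hn)
  have hP : (0 : ℝ) ≤ (n₀ + 1) ^ h := by positivity
  rcases lt_or_ge m n₀ with hlt | hge
  -- Below `n₀` nothing is known about `B`; the trivial bound is absorbed in the constant.
  · have h1 : repFun h B m ≤ (n₀ + 1) ^ h :=
      (repFun_le_pow h B m).trans (Nat.pow_le_pow_left (by omega) _)
    have h2 : (repFun h B m : ℝ) ≤ (n₀ + 1) ^ h := by exact_mod_cast h1
    nlinarith [abs_nonneg c]
  · rcases Nat.eq_zero_or_pos m with rfl | hm0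
    · have := hB 0 hge
      simp only [Nat.cast_zero, Real.log_zero, mul_zero] at this
      exact this.trans (by positivity)
    · have h1 : Real.log m ≤ Real.log n :=
        Real.log_le_log (by exact_mod_cast hm0) (by exact_mod_cast hm)
      have h0 : 0 ≤ Real.log m := Real.log_nonneg (by exact_mod_cast hm0)
      calc (repFun h B m : ℝ) ≤ c * Real.log m := hB m hge
        _ ≤ |c| * Real.log n := mul_le_mul (le_abs_self c) h1 h0 (abs_nonneg c)
        _ ≤ _ := by nlinarith

/-- The h-th power of the count is at most a sum of O(n) values of r_h, each O(log n), hence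
O(f(n)^h). -/
theorem exists_eventually_countUpTo_le (hh : 1 ≤ h)
    (hB : ∀ n ≥ n₀, (repFun h B n : ℝ) ≤ c * Real.log n) :
    ∃ C : ℝ, 0 ≤ C ∧ ∀ᶠ n : ℕ in atTop, (countUpTo B n : ℝ) ≤ C * growth h n := by
  obtain ⟨C, hC, hev⟩ := exists_eventually_repFun_le_log hB
  have hh0 : (1 : ℝ) ≤ h := by exact_mod_cast hh
  refine ⟨4 * h * C, by positivity, ?_⟩
  obtain ⟨n₁, hn₁⟩ := eventually_atTop.1 hev
  filter_upwards [eventually_ge_atTop n₁, eventually_ge_atTop h, eventually_ge_atTop 3]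
    with n hn hnh hn3
  have hn3' : (3 : ℝ) ≤ n := by exact_mod_cast hn3
  have hnh' : (h : ℝ) ≤ n := by exact_mod_cast hnh
  have hlog := one_le_log_of_three_le hn3'
  have hloghn : Real.log ((h * n : ℕ) : ℝ) ≤ 2 * Real.log n := by
    have : ((h * n : ℕ) : ℝ) ≤ (n : ℝ) ^ 2 := by push_cast; nlinarith
    have := Real.log_le_log (by push_cast; positivity) this
    rwa [Real.log_pow] at this
  have hpow : (countUpTo B n : ℝ) ^ h ≤
      ∑ m ∈ Finset.range (h * n + 1), (repFun h B m : ℝ) := by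
    exact_mod_cast pow_le_sum_repFun h B n
  refine le_of_pow_le_pow_left₀ (n := h) (by omega)
    (mul_nonneg (by positivity) (growth_nonneg (by linarith))) (hpow.trans ?_)
  calc ∑ m ∈ Finset.range (h * n + 1), (repFun h B m : ℝ)
      ≤ ((h * n + 1 : ℕ) : ℝ) * (C * (2 * Real.log n)) := by
        refine (Finset.sum_le_card_nsmul _ _ (C * (2 * Real.log n)) fun m hm => ?_).trans_eq
          (by rw [nsmul_eq_mul, Finset.card_range])
        refine (hn₁ (h * n) (by nlinarith) m
          (Nat.lt_succ_iff.1 (Finset.mem_range.1 hm))).trans ?_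
        gcongr
    _ ≤ (2 * h * n) * (C * (2 * Real.log n)) := by
        gcongr
        push_cast
        nlinarith
    _ = (4 * h * C) ^ 1 * (n * Real.log n) := by ring
    _ ≤ (4 * h * C) ^ h * (n * Real.log n) := by
        have : 1 ≤ 4 * h * C := by nlinarith
        gcongr
    _ = _ := by rw [mul_pow _ (growth h n), growth_pow hh (by linarith)]

/-- The h-th power of the count dominates the sum of r_h over (n/2, n], where each term is at least
half of log n. -/
theorem eventually_le_countUpTo (hh : 1 ≤ h)
    (hB : ∀ n ≥ n₀, Real.log n ≤ repFun h B n) :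
    ∀ᶠ n : ℕ in atTop, 1 / 4 * growth h n ≤ countUpTo B n := by
  filter_upwards [eventually_ge_atTop (2 * n₀), eventually_ge_atTop 4] with n hn hn4
  have hn4' : (4 : ℝ) ≤ n := by exact_mod_cast hn4
  have hlog := Real.log_nonneg (x := n) (by linarith)
  have hpow : ∑ m ∈ Finset.range (n + 1), (repFun h B m : ℝ) ≤ (countUpTo B n : ℝ) ^ h := by
    exact_mod_cast sum_repFun_le_pow h B n
  refine le_of_pow_le_pow_left₀ (n := h) (by omega) (Nat.cast_nonneg _) (le_trans ?_ hpow)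
  calc (1 / 4 * growth h n) ^ h = (1 / 4) ^ h * (n * Real.log n) := by
        rw [mul_pow, growth_pow hh (by linarith)]
    _ ≤ (1 / 4) ^ 1 * (n * Real.log n) := by
        refine mul_le_mul_of_nonneg_right ?_ (by positivity)
        exact pow_le_pow_of_le_one (by norm_num) (by norm_num) hh
    _ = (n / 2) * (Real.log n / 2) := by ring
    _ ≤ ((Finset.Ioc (n / 2) n).card : ℝ) * (Real.log n / 2) := by
        gcongr
        rw [Nat.card_Ioc, div_le_iff₀ (by norm_num)]
        have : n ≤ (n - n / 2) * 2 := by omega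
        exact_mod_cast this
    _ ≤ ∑ m ∈ Finset.Ioc (n / 2) n, (repFun h B m : ℝ) := by
        rw [← nsmul_eq_mul]
        refine Finset.card_nsmul_le_sum _ _ _ fun m hm => ?_
        rw [Finset.mem_Ioc] at hm
        refine le_trans ?_ (hB m (by omega))
        have : Real.log n ≤ 2 * Real.log m := by
          refine log_le_two_mul_log_of_div_le (D := 2) (by norm_num) (by linarith) ?_
          rw [div_le_iff₀ (by norm_num)]
          have : n ≤ m * 2 := by omega
          exact_mod_cast this
        linarith
    _ ≤ _ := by
        refine Finset.sum_le_sum_of_subset_of_nonneg (fun m hm => ?_)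
          fun _ _ _ => Nat.cast_nonneg _
        rw [Finset.mem_Ioc] at hm
        exact Finset.mem_range.2 (by omega)

/-- Uniformity in m ≤ n carries the induction: splitting off one summand evaluates the previous
bound at arbitrary smaller integers. -/
theorem exists_eventually_repFun_le (hh : 1 ≤ h)
    (hB : ∀ n ≥ n₀, (repFun h B n : ℝ) ≤ c * Real.log n) (j : ℕ) :
    ∃ C : ℝ, 0 ≤ C ∧ ∀ᶠ n : ℕ in atTop, ∀ m ≤ n,
      (repFun (h + j) B m : ℝ) ≤ C * (Real.log n * growth h n ^ j) := by
  induction j with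
  | zero =>
    obtain ⟨C, hC, hev⟩ := exists_eventually_repFun_le_log hB
    exact ⟨C, by linarith, by simpa using hev⟩
  | succ j ih =>
    obtain ⟨C, hC, hev⟩ := ih
    obtain ⟨C', hC', hev'⟩ := exists_eventually_countUpTo_le hh hB
    refine ⟨C' * C, mul_nonneg hC' hC, ?_⟩
    filter_upwards [hev, hev', eventually_ge_atTop 1] with n hn hn' hn1 m hm
    have hlog := Real.log_nonneg (x := n) (by exact_mod_cast hn1)
    have hG := growth_natCast_nonneg hh n
    have hcount : (countUpTo B m : ℝ) ≤ countUpTo B n := by exact_mod_cast countUpTo_mono B hm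
    calc (repFun (h + (j + 1)) B m : ℝ)
        ≤ countUpTo B m * (C * (Real.log n * growth h n ^ j)) :=
          repFun_succ_le_countUpTo_mul (h + j) B fun b hb => hn b (hb.trans hm)
      _ ≤ (C' * growth h n) * (C * (Real.log n * growth h n ^ j)) := by
          gcongr
          exact hcount.trans hn'
      _ = _ := by ring

theorem exists_eventually_le_repFun (hh : 1 ≤ h)
    (hB : ∀ n ≥ n₀, Real.log n ≤ repFun h B n) (j : ℕ) :
    ∃ C : ℝ, 0 < C ∧ ∀ᶠ n : ℕ in atTop,
      C * (Real.log n * growth h n ^ j) ≤ repFun (h + j) B n := by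
  induction j with
  | zero =>
    refine ⟨1, one_pos, ?_⟩
    filter_upwards [eventually_ge_atTop n₀] with n hn
    simpa using hB n hn
  | succ j ih =>
    obtain ⟨C, hC, hev⟩ := ih
    obtain ⟨n₁, hn₁⟩ := eventually_atTop.1 (hev.and (eventually_le_countUpTo hh hB))
    -- Only first summands up to n/2 are used. Both `n / 2` and the remainders are then at least n/3
    -- despite rounding; there f loses at most a factor 6 and log a factor 2, and 24 = 4 · 6.
    refine ⟨1 / 24 * (C * (1 / 2 * (1 / 6) ^ j)), by positivity, ?_⟩
    filter_upwards [eventually_ge_atTop (2 * n₁ + 1), eventually_ge_atTop 9] with n hn hn9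
    have hn9' : (9 : ℝ) ≤ n := by exact_mod_cast hn9
    have hlog := Real.log_nonneg (x := n) (by linarith)
    have hG := growth_natCast_nonneg hh n
    have hdiv : ∀ m : ℕ, n ≤ 3 * m → (n : ℝ) / 3 ≤ m := fun m hm => by
      rw [div_le_iff₀ (by norm_num)]
      have : n ≤ m * 3 := by omega
      exact_mod_cast this
    have hgrow : ∀ m : ℕ, n ≤ 3 * m → 1 / 6 * growth h n ≤ growth h m := fun m hm => by
      have := growth_le_of_div_le hh (D := 3) (by norm_num) (by linarith) (hdiv m hm)
      linarith
    have hlogm : ∀ m : ℕ, n ≤ 3 * m → 1 / 2 * Real.log n ≤ Real.log m := fun m hm => by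
      have := log_le_two_mul_log_of_div_le (D := 3) (by norm_num) (by linarith) (hdiv m hm)
      linarith
    calc 1 / 24 * (C * (1 / 2 * (1 / 6) ^ j)) * (Real.log n * growth h n ^ (j + 1))
        = (1 / 4 * (1 / 6 * growth h n)) *
          (C * ((1 / 2 * Real.log n) * (1 / 6 * growth h n) ^ j)) := by
          rw [mul_pow]; ring
      _ ≤ (countUpTo B (n / 2) : ℝ) *
          (C * ((1 / 2 * Real.log n) * (1 / 6 * growth h n) ^ j)) := by
          refine mul_le_mul_of_nonneg_right ?_ (by positivity)
          refine le_trans ?_ (hn₁ (n / 2) (by omega)).2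
          exact mul_le_mul_of_nonneg_left (hgrow _ (by omega)) (by norm_num)
      _ ≤ _ := by
          refine countUpTo_mul_le_repFun_succ (h + j) B (Nat.div_le_self n 2) fun a ha => ?_
          refine le_trans ?_ (hn₁ (n - a) (by omega)).1
          have h1 := hgrow (n - a) (by omega)
          have h2 := hlogm (n - a) (by omega)
          have h3 : 0 ≤ Real.log ((n - a : ℕ) : ℝ) := le_trans (by positivity) h2
          gcongr

end Regularity

/-! ### Conclusion -/

theorem theorem3p16 (h : ℕ) (hh : 2 ≤ h) :
    ∃ B : Set ℕ, B.Infinite ∧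
      IsThetaRegularBasis
        (fun x : ℝ => x ^ (1 / (h : ℝ)) * Real.log x ^ (1 / (h : ℝ))) h B := by
  obtain ⟨B, c, n₀, hB⟩ := exists_repFun_bounds hh
  have hh1 : 1 ≤ h := by omega
  have hh0 : (1 : ℝ) ≤ h := by exact_mod_cast hh1
  have hbasis : IsAsymptoticBasis h B := by
    filter_upwards [eventually_ge_atTop n₀, eventually_ge_atTop 3] with n hn hn3
    have h1 : (0 : ℝ) < repFun h B n := by
      have := one_le_log_of_three_le (x := n) (by exact_mod_cast hn3)
      linarith [(hB n hn).1]
    rw [Nat.cast_pos, repFun_eq_card, Finset.card_pos] at h1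
    obtain ⟨k, hk⟩ := h1
    exact ⟨k, (mem_repTuples.1 hk).2, (mem_repTuples.1 hk).1⟩
  refine ⟨B, fun hfin => ?_, ?_, hbasis, fun d hd => ?_⟩
  · obtain ⟨M, hM⟩ := hfin.bddAbove
    obtain ⟨n, hn, k, hkB, hk⟩ := ((eventually_gt_atTop (h * M)).and hbasis).exists
    have := Finset.sum_le_card_nsmul Finset.univ k M fun i _ => hM (hkB i)
    rw [hk, Finset.card_univ, Fintype.card_fin, smul_eq_mul] at this
    omega
  · filter_upwards [eventually_gt_atTop 1] with x hx
    exact (hasDerivAt_growth hx).differentiableAt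
  · obtain ⟨j, rfl⟩ := Nat.exists_eq_add_of_le hd
    change (fun n : ℕ => (repFun (h + j) B n : ℝ)) =Θ[atTop]
      fun n : ℕ => deriv (growth h) n * growth h n ^ (h + j - 1)
    -- The two sides differ by the factor (1 + 1/log n)/h, which lies between 1/h and 2.
    have hmain : (fun n : ℕ => deriv (growth h) n * growth h n ^ (h + j - 1)) =Θ[atTop]
        fun n : ℕ => Real.log n * growth h n ^ j := by
      constructor
      · refine IsBigO.of_bound 2 ?_
        filter_upwards [eventually_ge_atTop 3] with n hn
        have hn3 : (3 : ℝ) ≤ n := by exact_mod_cast hn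
        have hlog := one_le_log_of_three_le hn3
        rw [deriv_growth_mul_pow hh1 j (by linarith), norm_mul]
        refine mul_le_mul_of_nonneg_right ?_ (norm_nonneg _)
        rw [Real.norm_of_nonneg (by positivity)]
        have h1 : 1 / (h : ℝ) ≤ 1 := by rw [div_le_one (by linarith)]; exact hh0
        have h2 : 1 / Real.log n ≤ 1 := by rw [div_le_one (by linarith)]; exact hlog
        have h3 : 0 ≤ 1 / Real.log n := by positivity
        nlinarith
      · refine IsBigO.of_bound h ?_
        filter_upwards [eventually_ge_atTop 3] with n hn
        have hn3 : (3 : ℝ) ≤ n := by exact_mod_cast hn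
        have hlog := one_le_log_of_three_le hn3
        rw [deriv_growth_mul_pow hh1 j (by linarith), norm_mul _ (Real.log n * _), ← mul_assoc]
        refine le_mul_of_one_le_left (norm_nonneg _) ?_
        rw [Real.norm_of_nonneg (by positivity), ← mul_assoc, mul_one_div_cancel (by linarith),
          one_mul]
        have h3 : 0 ≤ 1 / Real.log n := by positivity
        linarith
    refine IsTheta.trans ?_ hmain.symm
    obtain ⟨C, hC, hev⟩ := exists_eventually_repFun_le hh1 (fun n hn => (hB n hn).2) j
    obtain ⟨C', hC', hev'⟩ := exists_eventually_le_repFun hh1 (fun n hn => (hB n hn).1) j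
    constructor
    · refine IsBigO.of_bound C ?_
      filter_upwards [hev] with n hn
      rw [Real.norm_of_nonneg (Nat.cast_nonneg _)]
      exact (hn n le_rfl).trans (mul_le_mul_of_nonneg_left (le_abs_self _) hC)
    · refine IsBigO.of_bound C'⁻¹ ?_
      filter_upwards [hev', eventually_ge_atTop 3] with n hn hn3
      have hlog := one_le_log_of_three_le (x := n) (by exact_mod_cast hn3)
      have hG := growth_natCast_nonneg hh1 n
      rw [Real.norm_of_nonneg (by positivity), Real.norm_of_nonneg (Nat.cast_nonneg _),
        le_inv_mul_iff₀ hC']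
      exact hn
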